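/- Let $n\ge 3$ and let $I$ be the inner product on $\mathbb R^n$ (basis $E_1,\dots,E_n$) given by the Lorentzian quadratic form $2x_1x_n+x_2^2+\cdots+x_{n-1}^2$. Let $\mathfrak g_0'=\mathfrak{so}(1,n-1)$ be the Lie algebra of $I$-skew endomorphisms and $G_0=\mathrm{CO}(1,n-1)$ the group of linear similarities of $I$. For $1\le i,j,k\le n-2$ put in $\mathfrak g_0'$: $B=E_1\otimes E_1^*-E_n\otimes E_n^*$, $U_i^+=E_1\otimes E_{i+1}^*-E_{i+1}\otimes E_n^*$, $R_{jk}=E_{j+1}\otimes E_{k+1}^*-E_{k+1}\otimes E_{j+1}^*$. Let $\mathbb V=\mathrm{Sym}^2(\mathfrak g_0')$, on which $O(1,n-1)$ acts by the symmetric square of the adjoint action and a dilation by $d\ne0$ acts as multiplication by $d^{-2}$. Let $\rho^\sharp_{Ric}$ be the linear map on $\mathbb V$ with $\rho^\sharp_{Ric}(U\cdot V)=\tfrac12(U\circ V+V\circ U)$. Let $\mathbb V^+_{Ric}$ be the set of the elements $$\varpi=\sum_{i,j}\alpha_{ij}\,U_i^+\cdot U_j^++\sum_i\beta_i\,U_i^+\cdot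 B+\sum_{i,j,k}\gamma_{ijk}\,U_i^+\cdot R_{jk},\qquad \alpha_{ij}=\alpha_{ji},\ \gamma_{ijk}=-\gamma_{ikj},$$ with $\rho^\sharp_{Ric}(\varpi)=0$, and $\mathbb V^+_B\subset\mathbb V^+_{Ric}$ the subset of those with $\beta_i=0$ for all $i$. For $n=3$ let $\mathbb U^\sim$ be the space of trace-free $I$-symmetric endomorphisms of $\mathbb R^3$, on which $SO(1,2)$ acts by conjugation and a dilation by $d\neq 0$ acts as multiplication by $d^{-3}$ (this determines an action of $G_0=\mathbb R^*\times SO(1,2)$). With $\xi_i={}^tE_i I$, let $\mathbb U^\sim_{+2}=\mathbb R\,E_1\cdot\xi_1$, $\mathbb U^\sim_{+1}=\mathbb R\,(E_1\cdot\xi_2+E_2\cdot\xi_1)$ and $\mathbb U^{\sim+}=\mathbb U^\sim_{+1}\oplus\mathbb U^\sim_{+2}$. A subset of a finite-dimensional real vector space is called Zariski closed if it is the set of common real zeros of a family of real polynomial functions, and $G_0.S$ denotes $\{g.s: g\in G_0,\ s\in S\}$. **Proposition.** If $n\ge4$, then $G_0.\mathbb V^+_{Ric}$ and $G_0.\mathbb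 V^+_B$ are Zariski closed in $\mathbb V$. Moreover, with $\mathbb W\subset\mathbb V$ the submodule of algebraic Weyl tensors (the elements of $\ker\rho^\sharp_{Ric}$ that satisfy the algebraic Bianchi identity), $G_0.(\mathbb V^+_{Ric}\cap\mathbb W)$ and $G_0.(\mathbb V^+_B\cap\mathbb W)$ are Zariski closed in $\mathbb V$, hence in $\mathbb W$. If $n=3$, then $G_0.\mathbb U^{\sim+}$ and $G_0.\mathbb U^\sim_{+2}$ are Zariski closed in $\mathbb U^\sim$. -/

import Mathlib

open scoped TensorProduct Matrix

noncomputable section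

/-! ### Zariski closed subsets of a real vector space -/

/-- The algebra of real polynomial functions on a real vector space `W`: the algebra of functions
generated by the linear forms (and the constants). -/
def polyFunctions (W : Type*) [AddCommGroup W] [Module ℝ W] : Subalgebra ℝ (W → ℝ) :=
  Algebra.adjoin ℝ (Set.range fun l : Module.Dual ℝ W => (l : W → ℝ))

/-- `S` is Zariski closed in `W`: it is the set of common zeros of a family of real polynomial
functions on `W`. -/
def IsZariskiClosed {W : Type*} [AddCommGroup W] [Module ℝ W] (S : Set W) : Prop :=
  ∃ F : Set (W → ℝ), F ⊆ polyFunctions W ∧ S = {w | ∀ f ∈ F, f w = 0}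

/-- The union `G.S` of the orbits, under a linear representation of `G`, of the points of `S`. -/
def orbitSet {G W : Type*} [Group G] [AddCommGroup W] [Module ℝ W] (ρ : Representation ℝ G W)
    (S : Set W) : Set W :=
  {w | ∃ g : G, ∃ v ∈ S, ρ g v = w}

/-! ### Minkowski space of dimension `n = m + 2` and its conformal group

The basis `E_1, …, E_n` is indexed by `Fin (m + 2)`, starting at `0`: `E_1` has index `0`, `E_n` has
index `Fin.last (m + 1)`, and `E_{i+1}` (`1 ≤ i ≤ n - 2`) has an index `midIdx i` with
`i : Fin m`. -/

/-- The index of the middle basis vectors. -/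
def midIdx {m : ℕ} (i : Fin m) : Fin (m + 2) := i.succ.castSucc

/-- The matrix of the Lorentzian inner product given by the quadratic form
`2 x_1 x_n + x_2 ^ 2 + ⋯ + x_{n-1} ^ 2`. -/
def minkowski (m : ℕ) : Matrix (Fin (m + 2)) (Fin (m + 2)) ℝ :=
  Matrix.of fun i j => if j = Equiv.swap 0 (Fin.last (m + 1)) i then 1 else 0

theorem minkowski_zero_last (m : ℕ) : minkowski m 0 (Fin.last (m + 1)) = 1 := by
  simp [minkowski]

/-- The group `G_0 = CO(1, n-1)` of linear similarities of the inner product. -/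
def conformalGroup (m : ℕ) : Subgroup (GL (Fin (m + 2)) ℝ) where
  carrier := {g | ∃ c : ℝ, 0 < c ∧
    (g : Matrix (Fin (m + 2)) (Fin (m + 2)) ℝ)ᵀ * minkowski m * g = c • minkowski m}
  one_mem' := ⟨1, one_pos, by simp⟩
  mul_mem' := by
    rintro g h ⟨c, hc, hg⟩ ⟨d, hd, hh⟩
    refine ⟨c * d, mul_pos hc hd, ?_⟩
    calc ((g * h : GL (Fin (m + 2)) ℝ) : Matrix (Fin (m + 2)) (Fin (m + 2)) ℝ)ᵀ * minkowski m
          * (g * h : GL (Fin (m + 2)) ℝ)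
        = (h : Matrix (Fin (m + 2)) (Fin (m + 2)) ℝ)ᵀ
          * ((g : Matrix (Fin (m + 2)) (Fin (m + 2)) ℝ)ᵀ * minkowski m * g) * h := by
          simp [Matrix.mul_assoc]
      _ = (c * d) • minkowski m := by
          rw [hg, Matrix.mul_smul, Matrix.smul_mul, hh, smul_smul]
  inv_mem' := by
    rintro g ⟨c, hc, hg⟩
    refine ⟨c⁻¹, inv_pos.mpr hc, ?_⟩
    have h1 : (g : Matrix (Fin (m + 2)) (Fin (m + 2)) ℝ)
        * ((g⁻¹ : GL (Fin (m + 2)) ℝ) : Matrix (Fin (m + 2)) (Fin (m + 2)) ℝ) = 1 :=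
      Units.mul_inv g
    have h2 : ((g⁻¹ : GL (Fin (m + 2)) ℝ) : Matrix (Fin (m + 2)) (Fin (m + 2)) ℝ)ᵀ
        * (g : Matrix (Fin (m + 2)) (Fin (m + 2)) ℝ)ᵀ = 1 := by
      rw [← Matrix.transpose_mul, h1, Matrix.transpose_one]
    have h3 : minkowski m = c⁻¹ •
        ((g : Matrix (Fin (m + 2)) (Fin (m + 2)) ℝ)ᵀ * minkowski m * g) := by
      rw [hg, smul_smul, inv_mul_cancel₀ hc.ne', one_smul]
    calc _ = c⁻¹ • ((((g⁻¹ : GL (Fin (m + 2)) ℝ) : Matrix (Fin (m + 2)) (Fin (m + 2)) ℝ)ᵀ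
            * (g : Matrix (Fin (m + 2)) (Fin (m + 2)) ℝ)ᵀ) * minkowski m
            * ((g : Matrix (Fin (m + 2)) (Fin (m + 2)) ℝ)
            * ((g⁻¹ : GL (Fin (m + 2)) ℝ) : Matrix (Fin (m + 2)) (Fin (m + 2)) ℝ))) := by
          conv_lhs => rw [h3]
          simp only [Matrix.mul_smul, Matrix.smul_mul, Matrix.mul_assoc]
      _ = _ := by rw [h1, h2, Matrix.one_mul, Matrix.mul_one]

/-- The matrix of an element of `G_0`. -/
abbrev confMatrix {m : ℕ} (g : conformalGroup m) : Matrix (Fin (m + 2)) (Fin (m + 2)) ℝ :=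
  ((g : GL (Fin (m + 2)) ℝ) : Matrix (Fin (m + 2)) (Fin (m + 2)) ℝ)

/-- The conformal factor of `g ∈ G_0`; see `conformalFactor_spec`. For `g = d h` with `d ≠ 0` a
scalar and `h` orthogonal it equals `d ^ 2`. -/
def conformalFactor {m : ℕ} (g : conformalGroup m) : ℝ :=
  ((confMatrix g)ᵀ * minkowski m * confMatrix g) 0 (Fin.last (m + 1))

theorem conformalFactor_pos_and_spec {m : ℕ} (g : conformalGroup m) :
    0 < conformalFactor g ∧
    (confMatrix g)ᵀ * minkowski m * confMatrix g = conformalFactor g • minkowski m := by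
  obtain ⟨c, hc, h⟩ := g.2
  have : conformalFactor g = c := by
    rw [conformalFactor, h, Matrix.smul_apply, minkowski_zero_last, smul_eq_mul, mul_one]
  rw [this]
  exact ⟨hc, h⟩

theorem conformalFactor_pos {m : ℕ} (g : conformalGroup m) : 0 < conformalFactor g :=
  (conformalFactor_pos_and_spec g).1

theorem conformalFactor_spec {m : ℕ} (g : conformalGroup m) :
    (confMatrix g)ᵀ * minkowski m * confMatrix g = conformalFactor g • minkowski m :=
  (conformalFactor_pos_and_spec g).2

theorem conformalFactor_one {m : ℕ} : conformalFactor (1 : conformalGroup m) = 1 := by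
  simp [conformalFactor, confMatrix, minkowski_zero_last]

theorem conformalFactor_mul {m : ℕ} (g h : conformalGroup m) :
    conformalFactor (g * h) = conformalFactor g * conformalFactor h := by
  have : (confMatrix (g * h))ᵀ * minkowski m * confMatrix (g * h)
      = (conformalFactor g * conformalFactor h) • minkowski m := by
    calc (confMatrix (g * h))ᵀ * minkowski m * confMatrix (g * h)
        = (confMatrix h)ᵀ * ((confMatrix g)ᵀ * minkowski m * confMatrix g) * confMatrix h := by
          simp [confMatrix, Matrix.mul_assoc]
      _ = _ := by
          rw [conformalFactor_spec, Matrix.mul_smul, Matrix.smul_mul, conformalFactor_spec,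
            smul_smul]
  rw [conformalFactor, this, Matrix.smul_apply, minkowski_zero_last, smul_eq_mul, mul_one]

/-- Conjugation `X ↦ g X g⁻¹` of matrices by elements of `G_0`. -/
def conjRep (m : ℕ) :
    Representation ℝ (conformalGroup m) (Matrix (Fin (m + 2)) (Fin (m + 2)) ℝ) where
  toFun g := LinearMap.mulLeft ℝ (confMatrix g) ∘ₗ LinearMap.mulRight ℝ (confMatrix g⁻¹)
  map_one' := by ext X; simp [confMatrix]
  map_mul' g h := by ext X; simp [confMatrix, Matrix.mul_assoc]

theorem conjRep_apply {m : ℕ} (g : conformalGroup m) (X : Matrix (Fin (m + 2)) (Fin (m + 2)) ℝ) :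
    conjRep m g X = confMatrix g * X * confMatrix g⁻¹ := by
  simp [conjRep, Matrix.mul_assoc]

theorem confMatrix_mul_inv {m : ℕ} (g : conformalGroup m) :
    confMatrix g * confMatrix g⁻¹ = 1 := by
  simp only [confMatrix, InvMemClass.coe_inv]
  exact Units.mul_inv _

theorem minkowski_conjRep {m : ℕ} (g : conformalGroup m)
    (X : Matrix (Fin (m + 2)) (Fin (m + 2)) ℝ) :
    minkowski m * conjRep m g X
      = conformalFactor g • ((confMatrix g⁻¹)ᵀ * (minkowski m * X) * confMatrix g⁻¹) := by
  have h1 : (confMatrix g⁻¹)ᵀ * (confMatrix g)ᵀ = 1 := by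
    rw [← Matrix.transpose_mul, confMatrix_mul_inv, Matrix.transpose_one]
  have h2 : minkowski m * confMatrix g = conformalFactor g • ((confMatrix g⁻¹)ᵀ * minkowski m) := by
    rw [← Matrix.mul_smul, ← conformalFactor_spec, ← Matrix.mul_assoc, ← Matrix.mul_assoc, h1,
      Matrix.one_mul]
  rw [conjRep_apply, Matrix.mul_assoc, ← Matrix.mul_assoc, h2]
  simp only [Matrix.smul_mul, Matrix.mul_assoc]

theorem minkowski_transpose (m : ℕ) : (minkowski m)ᵀ = minkowski m := by
  ext i j
  simp only [minkowski, Matrix.transpose_apply, Matrix.of_apply]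
  have h : i = Equiv.swap 0 (Fin.last (m + 1)) j ↔ j = Equiv.swap 0 (Fin.last (m + 1)) i := by
    rw [eq_comm, Equiv.swap_apply_eq_iff]
  simp only [h]

/-! ### The module `𝕍 = Sym²(𝔰𝔬(1, n-1))` -/

/-- The Lie algebra `𝔤_0' = 𝔰𝔬(1, n-1)`, as a space of matrices: those with `Xᵀ I = - I X`. -/
def soMatrices (m : ℕ) : Submodule ℝ (Matrix (Fin (m + 2)) (Fin (m + 2)) ℝ) :=
  skewAdjointMatricesSubmodule (minkowski m)

theorem mem_soMatrices {m : ℕ} (X : Matrix (Fin (m + 2)) (Fin (m + 2)) ℝ) :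
    X ∈ soMatrices m ↔ (minkowski m * X)ᵀ = -(minkowski m * X) := by
  rw [soMatrices, mem_skewAdjointMatricesSubmodule, Matrix.IsSkewAdjoint, Matrix.IsAdjointPair,
    Matrix.transpose_mul, minkowski_transpose, Matrix.mul_neg]

/-- The Lie algebra `𝔤_0' = 𝔰𝔬(1, n-1)`, as a type (the vector space structure is inherited from
the matrices). -/
def soAlg (m : ℕ) : Type := soMatrices m

instance soAlgAddCommGroup (m : ℕ) : AddCommGroup (soAlg m) :=
  inferInstanceAs (AddCommGroup (soMatrices m))

instance soAlgModule (m : ℕ) : Module ℝ (soAlg m) :=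
  inferInstanceAs (Module ℝ (soMatrices m))

/-- The inclusion of `𝔤_0'` in the space of matrices. -/
def soIncl (m : ℕ) : soAlg m →ₗ[ℝ] Matrix (Fin (m + 2)) (Fin (m + 2)) ℝ :=
  (soMatrices m).subtype

/-- The adjoint action of `G_0` on `𝔤_0'`. -/
def adRep (m : ℕ) : Representation ℝ (conformalGroup m) (soAlg m) where
  toFun g := (conjRep m g).restrict (p := soMatrices m) (q := soMatrices m) fun X hX => by
    rw [mem_soMatrices] at hX ⊢
    rw [minkowski_conjRep, Matrix.transpose_smul, Matrix.transpose_mul, Matrix.transpose_mul, hX]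
    simp [Matrix.mul_assoc]
  map_one' := by
    refine LinearMap.ext fun X => Subtype.ext ?_
    exact LinearMap.congr_fun (map_one (conjRep m)) (X : soMatrices m).1
  map_mul' g h := by
    refine LinearMap.ext fun X => Subtype.ext ?_
    exact LinearMap.congr_fun (map_mul (conjRep m) g h) (X : soMatrices m).1

theorem soIncl_adRep {m : ℕ} (g : conformalGroup m) (X : soAlg m) :
    soIncl m (adRep m g X) = confMatrix g * soIncl m X * confMatrix g⁻¹ :=
  conjRep_apply g _

/-- The symmetric square `Sym²(W)`, as the space of symmetric tensors in `W ⊗ W`. -/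
def symTensors (W : Type*) [AddCommGroup W] [Module ℝ W] : Submodule ℝ (W ⊗[ℝ] W) :=
  LinearMap.eqLocus (TensorProduct.comm ℝ W W).toLinearMap LinearMap.id

theorem mem_symTensors {W : Type*} [AddCommGroup W] [Module ℝ W] (t : W ⊗[ℝ] W) :
    t ∈ symTensors W ↔ TensorProduct.comm ℝ W W t = t := Iff.rfl

/-- The symmetric product `U · V = (U ⊗ V + V ⊗ U) / 2`. -/
def symProd {W : Type*} [AddCommGroup W] [Module ℝ W] (U V : W) : symTensors W :=
  ⟨(2⁻¹ : ℝ) • (U ⊗ₜ[ℝ] V + V ⊗ₜ[ℝ] U), by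
    rw [mem_symTensors, map_smul, map_add, TensorProduct.comm_tmul, TensorProduct.comm_tmul,
      add_comm (V ⊗ₜ[ℝ] U)]⟩

theorem comm_map_self {W : Type*} [AddCommGroup W] [Module ℝ W] (f : W →ₗ[ℝ] W) (t : W ⊗[ℝ] W) :
    TensorProduct.comm ℝ W W (TensorProduct.map f f t)
      = TensorProduct.map f f (TensorProduct.comm ℝ W W t) := by
  induction t with
  | zero => simp
  | tmul x y => simp
  | add x y hx hy => simp only [map_add, hx, hy]

/-- The symmetric square of a linear representation. -/
def symRep {G W : Type*} [Group G] [AddCommGroup W] [Module ℝ W] (ρ : Representation ℝ G W) :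
    Representation ℝ G (symTensors W) where
  toFun g := (TensorProduct.map (ρ g) (ρ g)).restrict fun t ht => by
    rw [mem_symTensors] at ht ⊢
    rw [comm_map_self, ht]
  map_one' := by ext1 t; apply Subtype.ext; simp
  map_mul' g h := by
    ext1 t
    apply Subtype.ext
    simp only [map_mul, TensorProduct.map_mul, LinearMap.coe_restrict_apply, Module.End.mul_apply]

/-- The `G_0`-module `𝕍 = Sym²(𝔤_0')`. -/
abbrev symSq (m : ℕ) : Type := symTensors (soAlg m)

/-- The representation of `G_0` on `𝕍`: elements of `O(1, n-1)` act by the symmetric square of the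
adjoint action, and a dilation by `d ≠ 0` acts as the scalar `d ^ (-2)`. -/
def weylRep (m : ℕ) : Representation ℝ (conformalGroup m) (symSq m) where
  toFun g := (conformalFactor g)⁻¹ • symRep (adRep m) g
  map_one' := by rw [conformalFactor_one, inv_one, one_smul, map_one]
  map_mul' g h := by
    rw [conformalFactor_mul, map_mul, mul_inv, smul_mul_smul_comm]

/-- The Ricci map `ρ : U · V ↦ (U ∘ V + V ∘ U) / 2` from `𝕍` to endomorphisms of Minkowski
space; see `ricciMap_symProd`. -/
def ricciMap (m : ℕ) : symSq m →ₗ[ℝ] Matrix (Fin (m + 2)) (Fin (m + 2)) ℝ :=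
  LinearMap.mul' ℝ _ ∘ₗ TensorProduct.map (soIncl m) (soIncl m) ∘ₗ (symTensors (soAlg m)).subtype

theorem ricciMap_symProd {m : ℕ} (U V : soAlg m) :
    ricciMap m (symProd U V) = (2⁻¹ : ℝ) • (soIncl m U * soIncl m V + soIncl m V * soIncl m U) := by
  simp [ricciMap, symProd]

theorem swap_midIdx {m : ℕ} (i : Fin m) :
    Equiv.swap 0 (Fin.last (m + 1)) (midIdx i) = midIdx i :=
  Equiv.swap_apply_of_ne_of_ne (by simp [midIdx, Fin.ext_iff]) (Fin.castSucc_lt_last _).ne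

theorem minkowski_mul_single {m : ℕ} (i j : Fin (m + 2)) :
    minkowski m * Matrix.single i j 1
      = Matrix.single (Equiv.swap 0 (Fin.last (m + 1)) i) j 1 := by
  ext a b
  rw [Matrix.mul_apply]
  simp only [minkowski, Matrix.of_apply, Matrix.single_apply, ite_mul, one_mul, zero_mul,
    Finset.sum_ite_eq', Finset.mem_univ, if_true]
  have h : i = Equiv.swap 0 (Fin.last (m + 1)) a ↔ Equiv.swap 0 (Fin.last (m + 1)) i = a := by
    rw [Equiv.swap_apply_eq_iff]
  simp only [h]

/-- The generator `B` of the split Cartan subalgebra of `𝔰𝔬(1, n-1)`: `E_1 ↦ E_1`,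
`E_n ↦ - E_n`. -/
def elemB (m : ℕ) : soAlg m :=
  ⟨Matrix.single 0 0 1 - Matrix.single (Fin.last (m + 1)) (Fin.last (m + 1)) 1, by
    simp [mem_soMatrices, Matrix.mul_sub, minkowski_mul_single]⟩

/-- The basis `U_i^+` of the nilpotent subalgebra `𝔲_+` (the root space of `β`). -/
def elemU {m : ℕ} (i : Fin m) : soAlg m :=
  ⟨Matrix.single 0 (midIdx i) 1 - Matrix.single (midIdx i) (Fin.last (m + 1)) 1, by
    simp [mem_soMatrices, Matrix.mul_sub, minkowski_mul_single, swap_midIdx]⟩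

/-- The elements `R_{jk} = - R_{kj}` of `𝔪 = 𝔰𝔬(n-2)`; those with `j < k` form a basis. -/
def elemR {m : ℕ} (j k : Fin m) : soAlg m :=
  ⟨Matrix.single (midIdx j) (midIdx k) 1 - Matrix.single (midIdx k) (midIdx j) 1, by
    simp [mem_soMatrices, Matrix.mul_sub, minkowski_mul_single, swap_midIdx]⟩

/-- The element
`∑ α_{ij} U_i^+ · U_j^+ + ∑ β_i U_i^+ · B + ∑ γ_{ijk} U_i^+ · R_{jk}` of `𝕍`. -/
def positiveElem {m : ℕ} (α : Fin m → Fin m → ℝ) (β : Fin m → ℝ)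
    (γ : Fin m → Fin m → Fin m → ℝ) : symSq m :=
  ∑ i, ∑ j, α i j • symProd (elemU i) (elemU j) + ∑ i, β i • symProd (elemU i) (elemB m)
    + ∑ i, ∑ j, ∑ k, γ i j k • symProd (elemU i) (elemR j k)

/-- `𝕍^+_Ric = (𝕍_{+2} ⊕ 𝕍_{+1}) ∩ ker ρ`. -/
def posRic (m : ℕ) : Set (symSq m) :=
  {w | (∃ α β γ, (∀ i j, α i j = α j i) ∧ (∀ i j k, γ i j k = -γ i k j) ∧
      w = positiveElem α β γ) ∧
    ricciMap m w = 0}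

/-- `𝕍^+_B`: the elements of `𝕍^+_Ric` for which all coefficients `β_i` vanish. -/
def posB (m : ℕ) : Set (symSq m) :=
  {w | (∃ α β γ, (∀ i j, α i j = α j i) ∧ (∀ i j k, γ i j k = -γ i k j) ∧
      w = positiveElem α β γ ∧ ∀ i, β i = 0) ∧
    ricciMap m w = 0}

/-- The covariant four-tensor of an element of `𝔤_0' ⊗ 𝔤_0'`: `U ⊗ V` is sent to
`(I U)_{ab} (I V)_{cd}`. -/
def lowered (m : ℕ) : soAlg m ⊗[ℝ] soAlg m →ₗ[ℝ]
    (Fin (m + 2) → Fin (m + 2) → Fin (m + 2) → Fin (m + 2) → ℝ) :=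
  TensorProduct.lift (LinearMap.mk₂ ℝ
    (fun U V a b c d => (minkowski m * soIncl m U) a b * (minkowski m * soIncl m V) c d)
    (by intros; ext; simp [Matrix.mul_add, add_mul])
    (by intros; ext; simp [mul_assoc])
    (by intros; ext; simp [mul_add])
    (by intros; ext; simp; ring))

/-- The algebraic Weyl tensors in `𝕍`: the elements of the kernel of the Ricci map that satisfy
the Bianchi identity. -/
def weylTensors (m : ℕ) : Submodule ℝ (symSq m) where
  carrier := {w | ricciMap m w = 0 ∧ ∀ a b c d,
    lowered m w a b c d + lowered m w b c a d + lowered m w c a b d = 0}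
  zero_mem' := by simp
  add_mem' := by
    rintro v w ⟨hv, hv'⟩ ⟨hw, hw'⟩
    refine ⟨by rw [map_add, hv, hw, add_zero], fun a b c d => ?_⟩
    simp only [Submodule.coe_add, map_add, Pi.add_apply]
    linarith [hv' a b c d, hw' a b c d]
  smul_mem' := by
    rintro r v ⟨hv, hv'⟩
    refine ⟨by rw [map_smul, hv, smul_zero], fun a b c d => ?_⟩
    simp only [Submodule.coe_smul, map_smul, Pi.smul_apply, smul_eq_mul]
    rw [← mul_add, ← mul_add, hv', mul_zero]

/-! ### The Cotton module in dimension three -/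

/-- `𝕌^∼`: the trace-free endomorphisms of three-dimensional Minkowski space that are symmetric
for the inner product. -/
def cottonModule : Submodule ℝ (Matrix (Fin (1 + 2)) (Fin (1 + 2)) ℝ) :=
  selfAdjointMatricesSubmodule (minkowski 1) ⊓ LinearMap.ker (Matrix.traceLinearMap _ ℝ ℝ)

theorem mem_cottonModule (X : Matrix (Fin (1 + 2)) (Fin (1 + 2)) ℝ) :
    X ∈ cottonModule ↔ (minkowski 1 * X)ᵀ = minkowski 1 * X ∧ X.trace = 0 := by
  rw [cottonModule, Submodule.mem_inf, mem_selfAdjointMatricesSubmodule, Matrix.IsSelfAdjoint,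
    Matrix.IsAdjointPair, Matrix.transpose_mul, minkowski_transpose, LinearMap.mem_ker,
    Matrix.traceLinearMap_apply]

/-- The representation of `G_0` on `𝕌^∼`: elements of `SO(1, 2)` act by conjugation, and a dilation
by `d ≠ 0` acts as the scalar `d ^ (-3)`. Every `g ∈ G_0` is uniquely `g = d h` with `d ≠ 0` and
`h ∈ SO(1, 2)`, and then `det g = d ^ 3`. -/
def cottonRep : Representation ℝ (conformalGroup 1) cottonModule where
  toFun g := ((confMatrix g).det)⁻¹ • (conjRep 1 g).restrict fun X hX => by
    rw [mem_cottonModule] at hX ⊢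
    constructor
    · rw [minkowski_conjRep, Matrix.transpose_smul, Matrix.transpose_mul, Matrix.transpose_mul,
        hX.1, Matrix.transpose_transpose]
      simp only [Matrix.mul_assoc]
    · have h := confMatrix_mul_inv g⁻¹
      rw [inv_inv] at h
      rw [conjRep_apply, Matrix.trace_mul_cycle, h, Matrix.one_mul, hX.2]
  map_one' := by ext1 X; apply Subtype.ext; simp [confMatrix]
  map_mul' g h := by
    ext1 X
    apply Subtype.ext
    simp only [confMatrix, Subgroup.coe_mul, Units.val_mul, Matrix.det_mul, map_mul, mul_inv,
      LinearMap.smul_apply, Submodule.coe_smul,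
      LinearMap.coe_restrict_apply, Module.End.mul_apply, map_smul, smul_smul]
    rw [mul_comm]

/-- The basis vector `E_{i+1}`. -/
def vecE (i : Fin (1 + 2)) : Fin (1 + 2) → ℝ := Pi.single i 1

/-- The covector `ξ_{i+1} = ᵗE_{i+1} I`. -/
def covecXi (i : Fin (1 + 2)) : Fin (1 + 2) → ℝ := vecE i ᵥ* minkowski 1

/-- The weight space `𝕌^∼_{+2}`, spanned by `E_1 · ξ_1`. -/
def cottonPosTwo : Submodule ℝ cottonModule :=
  (Submodule.span ℝ {Matrix.vecMulVec (vecE 0) (covecXi 0)}).submoduleOf cottonModule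

/-- The weight space `𝕌^∼_{+1}`, spanned by `E_1 · ξ_2 + E_2 · ξ_1`. -/
def cottonPosOne : Submodule ℝ cottonModule :=
  (Submodule.span ℝ {Matrix.vecMulVec (vecE 0) (covecXi 1)
    + Matrix.vecMulVec (vecE 1) (covecXi 0)}).submoduleOf cottonModule

end

/-! Call a real curvature-like tensor positive along a null line if it has only components of weight
one and two for the grading which that line defines. Elements of `G_0` carry the line of E_1 to any
real null line, so a tensor lies in the orbit of the positive tensors along E_1 exactly when it is
positive along some real null line. Stated over ℝ, such an existence condition is a priori only
semialgebraic.

Over ℂ it is Zariski closed: nullity and positivity along v are forms in v whose coefficients are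
polynomial in the tensor, and elimination theory (`exists_ne_zero_common_zero_iff`, from the
Nullstellensatz) makes the existence of a nonzero common zero a system of polynomial equations
(`isZariskiClosed_exists_ne_zero`).

The crux, `mem_orbitSet_iff_exists_null`, is that complex null lines contribute nothing new. A real
tensor positive along v is also positive along the conjugate of v. If v and its conjugate are not
orthogonal, the tensor vanishes (`IsPosAt.eq_zero`) and lies in the orbit anyway. If they are
orthogonal, the real and imaginary parts of v span a totally isotropic subspace; in Lorentzian
signature this has dimension one, so v is a multiple of a real null vector
(`exists_realVec_of_null`), to which a reflection carries E_1 up to scale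
(`exists_conformal_of_null`).

The explicit elements `positiveElem` are matched with the invariant notion in
`exists_positiveElem_iff` and `exists_positiveElem_of_beta_iff`. The Ricci and Bianchi conditions
are linear and invariant, so they only intersect the orbit with a submodule (`orbitSet_inter`).

In dimension three the two orbits are X ^ 3 = 0 and X ^ 2 = 0: a nilpotent symmetric endomorphism
kills a real null vector, which can be moved to E_1 up to scale. -/

/-! ### Operations on Zariski closed sets -/

theorem IsZariskiClosed.inter {W : Type*} [AddCommGroup W] [Module ℝ W] {S T : Set W}
    (hS : IsZariskiClosed S) (hT : IsZariskiClosed T) : IsZariskiClosed (S ∩ T) := by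
  obtain ⟨F, hF, rfl⟩ := hS
  obtain ⟨F', hF', rfl⟩ := hT
  refine ⟨F ∪ F', Set.union_subset hF hF', ?_⟩
  ext w
  simp only [Set.mem_inter_iff, Set.mem_ofPred_eq, Set.mem_union]
  exact ⟨fun h f hf => hf.elim (h.1 f) (h.2 f), fun h => ⟨fun f hf => h f (.inl hf),
    fun f hf => h f (.inr hf)⟩⟩

theorem isZariskiClosed_of_forall {W ι : Type*} [AddCommGroup W] [Module ℝ W] (f : ι → W → ℝ)
    (hf : ∀ i, f i ∈ polyFunctions W) : IsZariskiClosed {w | ∀ i, f i w = 0} :=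
  ⟨Set.range f, by rintro _ ⟨i, rfl⟩; exact hf i, by ext w; simp⟩

theorem dual_mem_polyFunctions {W : Type*} [AddCommGroup W] [Module ℝ W] (l : W →ₗ[ℝ] ℝ) :
    (fun w => l w) ∈ polyFunctions W :=
  Algebra.subset_adjoin ⟨l, rfl⟩

/-! ### Complex-valued polynomial functions -/

/-- The complex-valued functions whose real and imaginary parts are real polynomial functions. -/
def complexPolyFunctions (W : Type*) [AddCommGroup W] [Module ℝ W] : Subring (W → ℂ) where
  carrier := {f | (fun w => (f w).re) ∈ polyFunctions W ∧ (fun w => (f w).im) ∈ polyFunctions W}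
  zero_mem' := ⟨zero_mem (polyFunctions W), zero_mem (polyFunctions W)⟩
  one_mem' := ⟨one_mem (polyFunctions W), zero_mem (polyFunctions W)⟩
  add_mem' := fun hf hg => ⟨add_mem hf.1 hg.1, add_mem hf.2 hg.2⟩
  neg_mem' := fun hf => ⟨neg_mem hf.1, neg_mem hf.2⟩
  mul_mem' := fun hf hg =>
    ⟨sub_mem (mul_mem hf.1 hg.1) (mul_mem hf.2 hg.2),
      add_mem (mul_mem hf.1 hg.2) (mul_mem hf.2 hg.1)⟩

section

variable {W : Type*} [AddCommGroup W] [Module ℝ W]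

theorem linear_mem_complexPolyFunctions (l : W →ₗ[ℝ] ℂ) :
    (fun w => l w) ∈ complexPolyFunctions W :=
  ⟨dual_mem_polyFunctions (Complex.reLm ∘ₗ l), dual_mem_polyFunctions (Complex.imLm ∘ₗ l)⟩

theorem const_mem_complexPolyFunctions (c : ℂ) :
    (fun _ => c) ∈ complexPolyFunctions W :=
  ⟨(polyFunctions W).algebraMap_mem c.re, (polyFunctions W).algebraMap_mem c.im⟩

/-- Each complex equation is a pair of real ones. This is how the complex determinants of
elimination theory define real Zariski closed sets. -/
theorem isZariskiClosed_of_forall_complex {ι : Type*} (f : ι → W → ℂ)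
    (hf : ∀ i, f i ∈ complexPolyFunctions W) : IsZariskiClosed {w | ∀ i, f i w = 0} := by
  convert (isZariskiClosed_of_forall _ fun i => (hf i).1).inter
    (isZariskiClosed_of_forall _ fun i => (hf i).2) using 1
  ext w
  simp only [Set.mem_ofPred_eq, Set.mem_inter_iff, Complex.ext_iff, Complex.zero_re,
    Complex.zero_im, forall_and]

end

/-! ### Elimination theory -/

-- Projective elimination. The determinants are the maximal minors of the map sending multipliers of
-- the P_i to forms of degree N, so their vanishing says that the ideal does not contain all forms
-- of degree N. By the Nullstellensatz, this failure in every degree is equivalent to a nonzero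
-- common zero. Determinants are used because they are polynomial in the coefficients of the P_i.
open MvPolynomial in
theorem exists_ne_zero_common_zero_iff {σ ι : Type*} [Fintype σ] [DecidableEq σ]
    (P : ι → MvPolynomial σ ℂ) (d : ι → ℕ) (hP : ∀ i, (P i).IsHomogeneous (d i)) :
    (∃ v : σ → ℂ, v ≠ 0 ∧ ∀ i, eval v (P i) = 0) ↔
    ∀ (N : ℕ) (s : (Finset.univ : Finset σ).finsuppAntidiag N → (σ →₀ ℕ) × ι),
      (∀ k, (s k).1.degree + d (s k).2 = N) →
      (Matrix.of fun k m : (Finset.univ : Finset σ).finsuppAntidiag N =>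
        coeff m.1 (monomial (s k).1 1 * P (s k).2)).det = 0 := by
  have hmem : ∀ (N : ℕ) (m : σ →₀ ℕ),
      m ∈ (Finset.univ : Finset σ).finsuppAntidiag N ↔ m.degree = N := by
    intro N m
    simp [Finset.mem_finsuppAntidiag, Finsupp.degree_eq_sum]
  have hhom : ∀ (e : σ →₀ ℕ) (i : ι), (monomial e 1 * P i).IsHomogeneous (e.degree + d i) :=
    fun e i => (isHomogeneous_monomial _ rfl).mul (hP i)
  constructor
  · rintro ⟨v, hv, hz⟩ N s hs
    obtain ⟨i, hi⟩ := Function.ne_iff.1 hv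
    -- The kernel vector lists the values at v of all monomials of degree N; multiplying a row by it
    -- evaluates the corresponding multiple of P at v.
    refine Matrix.exists_mulVec_eq_zero_iff.1
      ⟨fun m => m.1.prod fun j n => v j ^ n, Function.ne_iff.2 ⟨⟨Finsupp.single i N, ?_⟩, ?_⟩, ?_⟩
    · rw [hmem, Finsupp.degree_single]
    · simpa using fun h => absurd h hi
    · funext k
      have h1 : eval v (monomial (s k).1 1 * P (s k).2) = 0 := by rw [map_mul, hz, mul_zero]
      rw [Pi.zero_apply, ← h1, eval_eq', Matrix.mulVec, dotProduct]
      simp only [Matrix.of_apply]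
      rw [Finset.sum_coe_sort _ fun m : σ →₀ ℕ =>
        coeff m (monomial (s k).1 1 * P (s k).2) * m.prod fun j n => v j ^ n]
      symm
      refine Finset.sum_subset_zero_on_sdiff (fun m hm => ?_) (fun m hm => ?_) (fun m _ => ?_)
      · rw [hmem, ← hs k]
        by_contra h
        exact (mem_support_iff.1 hm) ((hhom _ _).coeff_eq_zero h)
      · rw [notMem_support_iff.1 (Finset.mem_sdiff.1 hm).2, zero_mul]
      · rw [Finsupp.prod_fintype _ _ fun j => pow_zero _]
  · intro hdet
    by_contra! hno
    set I : Ideal (MvPolynomial σ ℂ) := Ideal.span (Set.range P) with hI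
    -- The only possible common zero is the origin, where every variable vanishes, so the
    -- Nullstellensatz applies.
    have hX : ∀ i, X i ∈ I.radical := by
      intro i
      rw [← vanishingIdeal_zeroLocus_eq_radical (K := ℂ)]
      intro v hv
      by_cases h0 : v = 0
      · simp [h0]
      · obtain ⟨j, hj⟩ := hno v h0
        exact absurd (hv (P j) (Ideal.subset_span ⟨j, rfl⟩)) (by simpa [aeval_eq_eval] using hj)
    choose n hn using hX
    set N := ∑ i, n i with hN
    -- Pigeonhole: in degree exceeding the sum of the n_i, some exponent reaches n_i. Taking N + 1
    -- rather than N also covers an empty set of variables.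
    have hmono : ∀ m : σ →₀ ℕ, m.degree = N + 1 → monomial m (1 : ℂ) ∈ I := by
      intro m hm
      obtain ⟨i, hi⟩ : ∃ i, n i ≤ m i := by
        by_contra! h
        have := Finset.sum_le_sum fun i (_ : i ∈ Finset.univ) => (h i).le
        rw [Finsupp.degree_eq_sum] at hm
        omega
      have : monomial m (1 : ℂ) = monomial (m - Finsupp.single i (n i)) 1 * X i ^ n i := by
        rw [X_pow_eq_monomial, monomial_mul, one_mul, tsub_add_cancel_of_le]
        simpa using hi
      rw [this]
      exact I.mul_mem_left _ (hn i)
    set κ := (Finset.univ : Finset σ).finsuppAntidiag (N + 1)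
    let L : MvPolynomial σ ℂ →ₗ[ℂ] (κ → ℂ) := LinearMap.pi fun m => lcoeff ℂ m.1
    let rows : Set (κ → ℂ) :=
      {r | ∃ (e : σ →₀ ℕ) (i : ι), e.degree + d i = N + 1 ∧ r = L (monomial e 1 * P i)}
    -- The degree N + 1 part of any element of I is a combination of admissible rows, because the
    -- generators are homogeneous: multiples of another degree have zero image under `L`.
    have hIL : ∀ x ∈ I, ∀ q, L (q * x) ∈ Submodule.span ℂ rows := by
      intro x hx
      induction hx using Submodule.span_induction with
      | mem x h =>
        obtain ⟨i, rfl⟩ := h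
        intro q
        induction q using MvPolynomial.induction_on' with
        | monomial e c =>
          have h1 : monomial e c * P i = c • (monomial e 1 * P i) := by
            rw [← smul_mul_assoc, smul_monomial, smul_eq_mul, mul_one]
          rw [h1, map_smul]
          refine Submodule.smul_mem _ _ ?_
          by_cases he : e.degree + d i = N + 1
          · exact Submodule.subset_span ⟨e, i, he, rfl⟩
          · convert Submodule.zero_mem _
            funext m
            refine (hhom e i).coeff_eq_zero ?_
            rw [(hmem _ _).1 m.2]
            exact fun h => he h.symm
        | add p q hp hq => rw [add_mul, map_add]; exact add_mem hp hq
      | zero => simp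
      | add x y _ _ hx hy => intro q; rw [mul_add, map_add]; exact add_mem (hx q) (hy q)
      | smul a x _ hx => intro q; rw [smul_eq_mul, ← mul_assoc]; exact hx _
    have hspan : Submodule.span ℂ rows = ⊤ := by
      rw [eq_top_iff, ← (Pi.basisFun ℂ κ).span_eq, Submodule.span_le]
      rintro _ ⟨m, rfl⟩
      have := hIL _ (hmono m.1 ((hmem _ _).1 m.2)) 1
      have h2 : Pi.basisFun ℂ κ m = L (1 * monomial m.1 1) := by
        funext m'
        simp only [Pi.basisFun_apply, Pi.single_apply, one_mul, L, LinearMap.pi_apply,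
          lcoeff_apply, coeff_monomial, Subtype.ext_iff, eq_comm (a := m.1)]
      rw [h2]
      exact this
    -- A basis extracted from the spanning rows is the row set of a square matrix of the kind in
    -- `hdet`, but with nonzero determinant.
    obtain ⟨b, hb, hbs, hli⟩ := exists_linearIndependent ℂ rows
    let B : Module.Basis b ℂ (κ → ℂ) := Module.Basis.mk hli (by
      rw [Subtype.range_coe, hbs, hspan])
    let eqv := (Pi.basisFun ℂ κ).indexEquiv B
    choose e i he hr using fun k : κ => hb (eqv k).2
    have h0 := hdet (N + 1) (fun k => (e k, i k)) he
    have hu : LinearIndependent ℂ (Matrix.of fun k m : κ =>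
        coeff m.1 (monomial (e k) 1 * P (i k))).row := by
      have h2 : (Matrix.of fun k m : κ => coeff m.1 (monomial (e k) 1 * P (i k))).row
          = (Subtype.val : b → κ → ℂ) ∘ eqv := funext fun k => (hr k).symm
      rw [h2]
      exact hli.comp eqv eqv.injective
    rw [Matrix.linearIndependent_rows_iff_isUnit, Matrix.isUnit_iff_isUnit_det, h0] at hu
    exact not_isUnit_zero hu

/-! ### Forms whose coefficients depend polynomially on a parameter. -/

section

variable {W : Type*} [AddCommGroup W] [Module ℝ W] {σ : Type*}

/-- `f w v` is a homogeneous polynomial of degree `d` in `v`, whose coefficients are polynomial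
functions of `w`. -/
def IsFormFamily (d : ℕ) (f : W → (σ → ℂ) → ℂ) : Prop :=
  ∃ P : W → MvPolynomial σ ℂ, (∀ w, (P w).IsHomogeneous d) ∧
    (∀ m, (fun w => MvPolynomial.coeff m (P w)) ∈ complexPolyFunctions W) ∧
    ∀ w v, MvPolynomial.eval v (P w) = f w v

theorem IsFormFamily.add {d : ℕ} {f g : W → (σ → ℂ) → ℂ} (hf : IsFormFamily d f)
    (hg : IsFormFamily d g) : IsFormFamily d (fun w v => f w v + g w v) := by
  obtain ⟨P, hP, hP', hPf⟩ := hf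
  obtain ⟨Q, hQ, hQ', hQg⟩ := hg
  refine ⟨fun w => P w + Q w, fun w => (hP w).add (hQ w), fun m => ?_, fun w v => ?_⟩
  · simp only [MvPolynomial.coeff_add]
    exact add_mem (hP' m) (hQ' m)
  · rw [map_add, hPf, hQg]

theorem IsFormFamily.neg {d : ℕ} {f : W → (σ → ℂ) → ℂ} (hf : IsFormFamily d f) :
    IsFormFamily d (fun w v => -f w v) := by
  obtain ⟨P, hP, hP', hPf⟩ := hf
  refine ⟨fun w => -P w, fun w => (hP w).neg, fun m => ?_, fun w v => ?_⟩
  · simp only [MvPolynomial.coeff_neg]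
    exact neg_mem (hP' m)
  · rw [map_neg, hPf]

theorem IsFormFamily.sub {d : ℕ} {f g : W → (σ → ℂ) → ℂ} (hf : IsFormFamily d f)
    (hg : IsFormFamily d g) : IsFormFamily d (fun w v => f w v - g w v) := by
  simpa only [sub_eq_add_neg] using hf.add hg.neg

theorem IsFormFamily.mul {d e : ℕ} {f g : W → (σ → ℂ) → ℂ} (hf : IsFormFamily d f)
    (hg : IsFormFamily e g) : IsFormFamily (d + e) (fun w v => f w v * g w v) := by
  classical
  obtain ⟨P, hP, hP', hPf⟩ := hf
  obtain ⟨Q, hQ, hQ', hQg⟩ := hg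
  refine ⟨fun w => P w * Q w, fun w => (hP w).mul (hQ w), fun m => ?_, fun w v => ?_⟩
  · have : (fun w => MvPolynomial.coeff m (P w * Q w)) = ∑ x ∈ Finset.HasAntidiagonal.antidiagonal m,
        (fun w => MvPolynomial.coeff x.1 (P w)) * (fun w => MvPolynomial.coeff x.2 (Q w)) := by
      funext w
      simp [MvPolynomial.coeff_mul]
    rw [this]
    exact sum_mem fun x _ => mul_mem (hP' x.1) (hQ' x.2)
  · rw [map_mul, hPf, hQg]

theorem IsFormFamily.sum {d : ℕ} {κ : Type*} (s : Finset κ) {f : κ → W → (σ → ℂ) → ℂ}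
    (hf : ∀ k ∈ s, IsFormFamily d (f k)) : IsFormFamily d (fun w v => ∑ k ∈ s, f k w v) := by
  classical
  induction s using Finset.induction_on with
  | empty =>
    exact ⟨fun _ => 0, fun _ => MvPolynomial.isHomogeneous_zero _ _ _,
      fun m => by simpa using const_mem_complexPolyFunctions 0, by simp⟩
  | insert a s ha ih =>
    simp only [Finset.sum_insert ha]
    exact (hf a (by simp)).add (ih fun k hk => hf k (by simp [hk]))

theorem isFormFamily_coord {f : W → ℂ} (hf : f ∈ complexPolyFunctions W) (i : σ) :
    IsFormFamily 1 (fun w (v : σ → ℂ) => v i * f w) := by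
  classical
  refine ⟨fun w => MvPolynomial.C (f w) * MvPolynomial.X i,
    fun w => MvPolynomial.isHomogeneous_C_mul_X _ _, fun m => ?_, fun w v => by simp [mul_comm]⟩
  simp only [MvPolynomial.coeff_C_mul]
  exact mul_mem hf (const_mem_complexPolyFunctions _)

theorem isFormFamily_linear [Fintype σ] [DecidableEq σ] (L : W → (σ → ℂ) →ₗ[ℂ] ℂ)
    (hL : ∀ x, (fun w => L w x) ∈ complexPolyFunctions W) :
    IsFormFamily 1 (fun w v => L w v) := by
  have : (fun w v => L w v) = fun w (v : σ → ℂ) => ∑ i, v i * L w (Pi.single i 1) := by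
    funext w v
    conv_lhs => rw [pi_eq_sum_univ' v]
    simp
  rw [this]
  exact IsFormFamily.sum _ fun i _ => isFormFamily_coord (hL _) i

theorem isFormFamily_bilinear [Fintype σ] [DecidableEq σ]
    (L : W → (σ → ℂ) →ₗ[ℂ] (σ → ℂ) →ₗ[ℂ] ℂ)
    (hL : ∀ x y, (fun w => L w x y) ∈ complexPolyFunctions W) :
    IsFormFamily 2 (fun w v => L w v v) := by
  have : (fun w v => L w v v) = fun w (v : σ → ℂ) =>
      ∑ i, (v i * 1) * (L w).flip (Pi.single i 1) v := by
    funext w v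
    nth_rewrite 2 [pi_eq_sum_univ' v]
    simp
  rw [this]
  exact IsFormFamily.sum _ fun i _ => (isFormFamily_coord (one_mem _) i).mul
    (isFormFamily_linear (fun w => (L w).flip (Pi.single i 1)) fun x => hL x _)

/-- The set of the parameters for which a family of forms has a nontrivial common complex zero
is Zariski closed. -/
theorem isZariskiClosed_exists_ne_zero [Fintype σ] {ι : Type*} (d : ι → ℕ)
    (f : ι → W → (σ → ℂ) → ℂ) (hf : ∀ i, IsFormFamily (d i) (f i)) :
    IsZariskiClosed {w | ∃ v : σ → ℂ, v ≠ 0 ∧ ∀ i, f i w v = 0} := by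
  classical
  choose P hP hP' hPf using hf
  let J := Σ N : ℕ, {s : (Finset.univ : Finset σ).finsuppAntidiag N → (σ →₀ ℕ) × ι //
    ∀ k, (s k).1.degree + d (s k).2 = N}
  convert isZariskiClosed_of_forall_complex
    (fun (j : J) w => (Matrix.of fun k m : (Finset.univ : Finset σ).finsuppAntidiag j.1 =>
        MvPolynomial.coeff m.1 (MvPolynomial.monomial (j.2.1 k).1 1 * P (j.2.1 k).2 w)).det)
    (fun j => ?_) using 1
  · ext w
    simp only [Set.mem_ofPred_eq, ← hPf]
    rw [exists_ne_zero_common_zero_iff (fun i => P i w) d fun i => hP i w]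
    exact ⟨fun h j => h j.1 j.2.1 j.2.2, fun h N s hs => h ⟨N, s, hs⟩⟩
  -- The determinant is taken in the ring of functions `W → ℂ`, where it is visibly a signed sum of
  -- products of members of the subring.
  · have : (fun w => (Matrix.of fun k m : (Finset.univ : Finset σ).finsuppAntidiag j.1 =>
        MvPolynomial.coeff m.1 (MvPolynomial.monomial (j.2.1 k).1 1 * P (j.2.1 k).2 w)).det)
        = (Matrix.of fun k m : (Finset.univ : Finset σ).finsuppAntidiag j.1 => fun w =>
        MvPolynomial.coeff m.1 (MvPolynomial.monomial (j.2.1 k).1 1 * P (j.2.1 k).2 w)).det := by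
      funext w
      simp [Matrix.det_apply]
    rw [this, Matrix.det_apply]
    refine sum_mem fun τ _ => zsmul_mem (prod_mem fun k _ => ?_) _
    simp only [Matrix.of_apply, MvPolynomial.coeff_monomial_mul', one_mul]
    split_ifs
    · exact hP' _ _
    · exact zero_mem _

end

/-! ### Four-linear forms of positive weight along a null vector -/

section

variable {K V : Type*} [Field K] [AddCommGroup V] [Module K V]

/-- The contraction of the first two arguments of a four-linear form, viewed as a bivector, with
the bivector obtained by inserting `v` in `q ∧ r ∧ s`. -/
def contrForm (b : V →ₗ[K] V →ₗ[K] K) (T : V →ₗ[K] V →ₗ[K] V →ₗ[K] V →ₗ[K] K)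
    (v q r s z t : V) : K :=
  b v q * T r s z t + b v r * T s q z t + b v s * T q r z t

/-- The form obtained from `T` by inserting `ι_v (q ∧ r ∧ s)` and `ι_v (q' ∧ r' ∧ s')`. -/
def coreForm (b : V →ₗ[K] V →ₗ[K] K) (T : V →ₗ[K] V →ₗ[K] V →ₗ[K] V →ₗ[K] K)
    (v q r s q' r' s' : V) : K :=
  b v q' * contrForm b T v q r s r' s' + b v r' * contrForm b T v q r s s' q'
    + b v s' * contrForm b T v q r s q' r'

/-- A curvature-like form `T` has only components of positive weight along the null vector `v`:
`T` vanishes if one argument is a bivector `v ∧ y` with `y ⊥ v`, and if both arguments are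
bivectors stabilizing the line of `v`. -/
structure IsPosAt (b : V →ₗ[K] V →ₗ[K] K) (T : V →ₗ[K] V →ₗ[K] V →ₗ[K] V →ₗ[K] K) (v : V) :
    Prop where
  -- Quantifiers over y ⊥ v are avoided so that every condition is a form in v: for nondegenerate
  -- `b` and v ≠ 0, the vectors b(v, q) p - b(v, p) q span the orthogonal complement of v. Likewise
  -- the bivectors ι_v (q ∧ r ∧ s) span its second exterior power, which together with the v ∧ p
  -- gives the stabilizer of the line of a null v.
  left : ∀ p q z t, b v q * T v p z t - b v p * T v q z t = 0
  diag : ∀ p q, T v p v q = 0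
  mixed : ∀ p q r s, b v q * T v p r s + b v r * T v p s q + b v s * T v p q r = 0
  core : ∀ q r s q' r' s', coreForm b T v q r s q' r' s' = 0

/-- A curvature-like form `T` has only components of positive weight along the null vector `v`, and
is annihilated by `v`. -/
structure IsNullAt (b : V →ₗ[K] V →ₗ[K] K) (T : V →ₗ[K] V →ₗ[K] V →ₗ[K] V →ₗ[K] K) (v : V) :
    Prop where
  left : ∀ p z t, T v p z t = 0
  core : ∀ q r s q' r' s', coreForm b T v q r s q' r' s' = 0

variable {b : V →ₗ[K] V →ₗ[K] K} {T S : V →ₗ[K] V →ₗ[K] V →ₗ[K] V →ₗ[K] K} {u v : V}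

theorem IsNullAt.isPosAt (h : IsNullAt b T v) : IsPosAt b T v :=
  ⟨fun p q z t => by simp [h.left], fun p q => h.left _ _ _, fun p q r s => by simp [h.left],
    h.core⟩

theorem isPosAt_zero : IsPosAt b 0 v :=
  ⟨by simp, by simp, by simp, by simp [coreForm, contrForm]⟩

theorem IsPosAt.add (hT : IsPosAt b T v) (hS : IsPosAt b S v) : IsPosAt b (T + S) v where
  left p q z t := by
    simp only [LinearMap.add_apply]
    linear_combination hT.left p q z t + hS.left p q z t
  diag p q := by simp only [LinearMap.add_apply, hT.diag, hS.diag, add_zero]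
  mixed p q r s := by
    simp only [LinearMap.add_apply]
    linear_combination hT.mixed p q r s + hS.mixed p q r s
  core q r s q' r' s' := by
    have h1 := hT.core q r s q' r' s'
    have h2 := hS.core q r s q' r' s'
    simp only [coreForm, contrForm, LinearMap.add_apply] at h1 h2 ⊢
    linear_combination h1 + h2

theorem IsPosAt.smul (c : K) (hT : IsPosAt b T v) : IsPosAt b (c • T) v where
  left p q z t := by
    simp only [LinearMap.smul_apply, smul_eq_mul]
    linear_combination c * hT.left p q z t
  diag p q := by simp only [LinearMap.smul_apply, hT.diag, smul_zero]
  mixed p q r s := by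
    simp only [LinearMap.smul_apply, smul_eq_mul]
    linear_combination c * hT.mixed p q r s
  core q r s q' r' s' := by
    have h1 := hT.core q r s q' r' s'
    simp only [coreForm, contrForm, LinearMap.smul_apply, smul_eq_mul] at h1 ⊢
    linear_combination c * h1

theorem IsPosAt.of_smul {c : K} (hc : c ≠ 0) (hT : IsPosAt b T (c • v)) : IsPosAt b T v where
  left p q z t := by
    have h := hT.left p q z t
    simp only [map_smul, LinearMap.smul_apply, smul_eq_mul] at h
    exact mul_left_cancel₀ (pow_ne_zero 2 hc) (by linear_combination h)
  diag p q := by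
    have h := hT.diag p q
    simp only [map_smul, LinearMap.smul_apply, smul_eq_mul] at h
    exact mul_left_cancel₀ (pow_ne_zero 2 hc) (by linear_combination h)
  mixed p q r s := by
    have h := hT.mixed p q r s
    simp only [map_smul, LinearMap.smul_apply, smul_eq_mul] at h
    exact mul_left_cancel₀ (pow_ne_zero 2 hc) (by linear_combination h)
  core q r s q' r' s' := by
    have h := hT.core q r s q' r' s'
    simp only [coreForm, contrForm, map_smul, LinearMap.smul_apply, smul_eq_mul] at h ⊢
    exact mul_left_cancel₀ (pow_ne_zero 2 hc) (by linear_combination h)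

theorem IsNullAt.of_smul {c : K} (hc : c ≠ 0) (hT : IsNullAt b T (c • v)) : IsNullAt b T v where
  left p z t := by
    have h := hT.left p z t
    simp only [map_smul, LinearMap.smul_apply, smul_eq_mul] at h
    exact (mul_eq_zero.1 h).resolve_left hc
  core := (hT.isPosAt.of_smul hc).core

/-- A form of positive weight along two transversal null vectors vanishes. -/
theorem IsPosAt.eq_zero (hb : ∀ x y, b x y = b y x) (hT : ∀ x y z t, T x y z t = -T y x z t)
    (hT' : ∀ x y z t, T x y z t = T z t x y) (hv : IsPosAt b T v) (hu : IsPosAt b T u)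
    (huv : b v u ≠ 0) : T = 0 := by
  -- Since u ∧ y is killed for y ⊥ u, any u ∧ y may be replaced by a multiple of u ∧ v. Expanding
  -- ι_v (u ∧ x ∧ y) then expresses x ∧ y through ι_v (u ∧ x ∧ y) and u ∧ v. Only the `left`
  -- condition at u enters the proof.
  have key : ∀ x y z t, b v u ^ 2 * T x y z t = b v u * contrForm b T v u x y z t
      + (b v x * b u y - b v y * b u x) * T u v z t := by
    intro x y z t
    have h1 := hu.left y v z t
    have h2 := hu.left x v z t
    rw [hb u v] at h1 h2
    have h3 := hT y u z t
    rw [contrForm]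
    linear_combination b v x * h1 - b v y * h2 - b v u * b v x * h3
  have key' : ∀ x y z t, b v u ^ 2 * T x y z t
      = b v u * (b v u * T x y z t + b v z * T x y t u + b v t * T x y u z)
        + (b v z * b u t - b v t * b u z) * T x y u v := by
    intro x y z t
    have h := key z t x y
    rw [contrForm] at h
    simpa only [hT' _ _ x y] using h
  -- The second pair is decomposed by `key'`: `mixed` at v kills the contraction and `diag` at v
  -- kills the u ∧ v part.
  have hvu : ∀ z t, T u v z t = 0 := by
    intro z t
    have h := key' u v z t
    have h1 := hv.mixed u u z t
    have h2 := hv.diag u u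
    have h3 := hT u v z t
    have h4 := hT u v t u
    have h5 := hT u v u z
    have h6 := hT u v u v
    have h7 := hT' v u u v
    have h8 := hT u v v u
    refine mul_left_cancel₀ (pow_ne_zero 2 huv) ?_
    linear_combination h - b v u * h1 + b v u * (b v u * h3 + b v z * h4 + b v t * h5)
      + (b v z * b u t - b v t * b u z) * (h6 - h7 - h8 + h2)
  -- Again the second pair is decomposed: `core` at v kills the contraction and `hvu` the u ∧ v
  -- part.
  have hc : ∀ x y z t, contrForm b T v u x y z t = 0 := by
    intro x y z t
    have h := hv.core u x y u z t
    have h1 := key' x y z t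
    have h2 := key' y u z t
    have h3 := key' u x z t
    have h4 := hvu x y
    have h5 := hvu y u
    have h6 := hvu u x
    rw [hT'] at h4 h5 h6
    rw [h4] at h1
    rw [h5] at h2
    rw [h6] at h3
    refine mul_left_cancel₀ (pow_ne_zero 2 huv) ?_
    simp only [coreForm, contrForm] at h ⊢
    linear_combination b v u * h1 + b v x * h2 + b v y * h3 + b v u * h
  ext x y z t
  have h := key x y z t
  rw [hc, hvu] at h
  refine mul_left_cancel₀ (pow_ne_zero 2 huv) ?_
  simpa using h

end

/-! ### Complexified Minkowski space -/

/-- The complex bilinear extension of the Minkowski inner product. -/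
def complexMink (m : ℕ) : (Fin (m + 2) → ℂ) →ₗ[ℂ] (Fin (m + 2) → ℂ) →ₗ[ℂ] ℂ :=
  Matrix.toLinearMap₂' ℂ ((minkowski m).map Complex.ofReal)

theorem complexMink_apply {m : ℕ} (x y : Fin (m + 2) → ℂ) :
    complexMink m x y = x ⬝ᵥ (minkowski m).map Complex.ofReal *ᵥ y :=
  Matrix.toLinearMap₂'_apply' _ _ _

theorem sum_fin_split {M : Type*} [AddCommMonoid M] {m : ℕ} (f : Fin (m + 2) → M) :
    ∑ i, f i = f 0 + ∑ i : Fin m, f (midIdx i) + f (Fin.last (m + 1)) := by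
  rw [Fin.sum_univ_castSucc, Fin.sum_univ_succ]
  rfl

theorem minkowski_mulVec {R : Type*} [CommSemiring R] {m : ℕ} (f : ℝ →+* R) (y : Fin (m + 2) → R)
    (i : Fin (m + 2)) :
    ((minkowski m).map f *ᵥ y) i = y (Equiv.swap 0 (Fin.last (m + 1)) i) := by
  simp [Matrix.mulVec, dotProduct, minkowski, apply_ite f]

theorem complexMink_eq {m : ℕ} (x y : Fin (m + 2) → ℂ) :
    complexMink m x y = x 0 * y (Fin.last (m + 1)) + ∑ i : Fin m, x (midIdx i) * y (midIdx i)
      + x (Fin.last (m + 1)) * y 0 := by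
  have h := minkowski_mulVec (m := m) Complex.ofRealHom y
  rw [complexMink_apply, dotProduct, sum_fin_split]
  erw [h, h]
  simp only [Equiv.swap_apply_left, Equiv.swap_apply_right]
  congr 2
  refine Finset.sum_congr rfl fun i _ => ?_
  erw [h, swap_midIdx]

theorem complexMink_comm {m : ℕ} (x y : Fin (m + 2) → ℂ) :
    complexMink m x y = complexMink m y x := by
  simp only [complexMink_eq, mul_comm (x _)]
  ring

/-- The real vectors in complexified Minkowski space. -/
def realVec {m : ℕ} (x : Fin (m + 2) → ℝ) : Fin (m + 2) → ℂ := fun i => (x i : ℂ)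

/-- A complex null vector that is orthogonal to its conjugate is a multiple of a real vector. -/
theorem exists_realVec_of_null {m : ℕ} {v : Fin (m + 2) → ℂ} (hv : v ≠ 0)
    (h : complexMink m v v = 0) (h' : complexMink m v (star v) = 0) :
    ∃ (c : ℂ) (x : Fin (m + 2) → ℝ), c ≠ 0 ∧ v = c • realVec x := by
  rw [complexMink_eq] at h h'
  have hext : ∀ x y : Fin (m + 2) → ℂ, x 0 = y 0 → (∀ i, x (midIdx i) = y (midIdx i)) →
      x (Fin.last (m + 1)) = y (Fin.last (m + 1)) → x = y := by
    intro x y h0 h1 h2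
    funext i
    induction i using Fin.lastCases with
    | last => exact h2
    | cast i =>
      induction i using Fin.cases with
      | zero => exact h0
      | succ i => exact h1 i
  -- If the last coordinate vanishes, orthogonality to the conjugate says that the squared moduli of
  -- the middle coordinates sum to zero, so v is a multiple of E_1. Otherwise the last coordinate is
  -- normalized to 1.
  by_cases hl : v (Fin.last (m + 1)) = 0
  · have hm : ∀ i, v (midIdx i) = 0 := by
      have h1 : ∑ i : Fin m, Complex.normSq (v (midIdx i)) = 0 := by
        have h2 := congrArg Complex.re h'
        simpa [hl, Complex.mul_conj] using h2
      intro i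
      rw [Finset.sum_eq_zero_iff_of_nonneg fun i _ => Complex.normSq_nonneg _] at h1
      exact Complex.normSq_eq_zero.1 (h1 i (Finset.mem_univ _))
    have hv' : v = v 0 • realVec (Pi.single 0 1) := by
      refine hext _ _ ?_ (fun i => ?_) ?_
      · simp [realVec]
      · rw [hm]
        simp [realVec, midIdx, Fin.ext_iff]
      · simp [hl, realVec, Fin.ext_iff]
    refine ⟨v 0, _, fun h0 => hv ?_, hv'⟩
    rw [hv', h0, zero_smul]
  · obtain ⟨c, u, hc, hul, rfl⟩ : ∃ (c : ℂ) (u : Fin (m + 2) → ℂ), c ≠ 0 ∧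
        u (Fin.last (m + 1)) = 1 ∧ v = c • u :=
      ⟨v (Fin.last (m + 1)), (v (Fin.last (m + 1)))⁻¹ • v, hl, by simp [hl],
        by rw [smul_inv_smul₀ hl]⟩
    have hs : star (c • u) = star c • star u := star_smul c u
    rw [← complexMink_eq] at h h'
    rw [hs] at h'
    simp only [map_smul, LinearMap.smul_apply, smul_eq_mul, mul_eq_zero, hc, star_eq_zero,
      false_or] at h h'
    rw [complexMink_eq, hul] at h h'
    simp only [Pi.star_apply, hul, star_one] at h'
    have h1 := congrArg Complex.re h
    have h2 := congrArg Complex.re h'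
    have h3 := congrArg Complex.im h
    simp only [mul_one, one_mul, Complex.add_re, Complex.add_im, Complex.re_sum, Complex.im_sum,
      Complex.mul_re, Complex.mul_im, Complex.star_def, Complex.conj_re, Complex.conj_im,
      Complex.zero_re, Complex.zero_im] at h1 h2 h3
    -- The real parts of the two equations differ only in the sign of the squared imaginary parts of
    -- the middle coordinates. The imaginary part of the null equation then makes u 0 real.
    have hm : ∀ i, (u (midIdx i)).im = 0 := by
      have h4 : ∑ i : Fin m, (u (midIdx i)).im * (u (midIdx i)).im = 0 := by
        rw [Finset.sum_sub_distrib] at h1 h2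
        simp only [mul_neg, Finset.sum_neg_distrib] at h2
        linarith
      intro i
      rw [Finset.sum_eq_zero_iff_of_nonneg fun i _ => mul_self_nonneg _] at h4
      exact mul_self_eq_zero.1 (h4 i (Finset.mem_univ _))
    simp only [hm, mul_zero, zero_mul, add_zero, Finset.sum_const_zero] at h3
    refine ⟨c, fun i => (u i).re, hc, congrArg (c • ·) (hext _ _ ?_ (fun i => ?_) ?_)⟩
    · apply Complex.ext <;> simp [realVec]
      linarith
    · apply Complex.ext <;> simp [realVec, hm]
    · simp [realVec, hul]

/-! ### Transport of positivity -/

section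

variable {K V : Type*} [Field K] [AddCommGroup V] [Module K V]
  {b : V →ₗ[K] V →ₗ[K] K} {T S : V →ₗ[K] V →ₗ[K] V →ₗ[K] V →ₗ[K] K} {v : V}

theorem coreForm_transport {h : V →ₗ[K] V} {c : K} (hb : ∀ x y, b x y = c * b (h x) (h y))
    (hS : ∀ x y z t, S x y z t = c * T (h x) (h y) (h z) (h t)) (q r s q' r' s' : V) :
    coreForm b S v q r s q' r' s'
      = c ^ 3 * coreForm b T (h v) (h q) (h r) (h s) (h q') (h r') (h s') := by
  simp only [coreForm, contrForm, hb v, hS]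
  ring

theorem IsPosAt.transport {h : V →ₗ[K] V} {c : K} (hb : ∀ x y, b x y = c * b (h x) (h y))
    (hS : ∀ x y z t, S x y z t = c * T (h x) (h y) (h z) (h t)) (hT : IsPosAt b T (h v)) :
    IsPosAt b S v where
  left p q z t := by
    rw [hb v, hb v, hS, hS]
    linear_combination c ^ 2 * hT.left (h p) (h q) (h z) (h t)
  diag p q := by rw [hS, hT.diag, mul_zero]
  mixed p q r s := by
    rw [hb v, hb v, hb v, hS, hS, hS]
    linear_combination c ^ 2 * hT.mixed (h p) (h q) (h r) (h s)
  core q r s q' r' s' := by rw [coreForm_transport hb hS, hT.core, mul_zero]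

theorem IsNullAt.transport {h : V →ₗ[K] V} {c : K} (hb : ∀ x y, b x y = c * b (h x) (h y))
    (hS : ∀ x y z t, S x y z t = c * T (h x) (h y) (h z) (h t)) (hT : IsNullAt b T (h v)) :
    IsNullAt b S v where
  left p z t := by rw [hS, hT.left, mul_zero]
  core q r s q' r' s' := by rw [coreForm_transport hb hS, hT.core, mul_zero]

end

/-! ### The complex four-linear form of a curvature-like tensor -/

/-- The complex bilinear form of an element of the orthogonal Lie algebra. -/
def soForm {m : ℕ} (U : soAlg m) (x y : Fin (m + 2) → ℂ) : ℂ :=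
  x ⬝ᵥ (minkowski m * soIncl m U).map Complex.ofReal *ᵥ y

/-- The complex four-linear form with a given array of real coefficients. -/
def fourForm {n : Type*} [Fintype n] (t : n → n → n → n → ℝ) :
    (n → ℂ) →ₗ[ℂ] (n → ℂ) →ₗ[ℂ] (n → ℂ) →ₗ[ℂ] (n → ℂ) →ₗ[ℂ] ℂ :=
  ∑ a, ∑ b, ∑ c, ∑ d, (LinearMap.proj a).smulRight ((LinearMap.proj b).smulRight
    ((LinearMap.proj c).smulRight ((t a b c d : ℂ) • LinearMap.proj d)))

theorem fourForm_apply {n : Type*} [Fintype n] (f : n → n → n → n → ℝ) (x y z t : n → ℂ) :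
    fourForm f x y z t = ∑ a, ∑ b, ∑ c, ∑ d, x a * (y b * (z c * ((f a b c d : ℂ) * t d))) := by
  simp only [fourForm, LinearMap.sum_apply, LinearMap.smulRight_apply, LinearMap.smul_apply,
    LinearMap.proj_apply, smul_eq_mul]

/-- The complex multilinear extension of the covariant four-tensor of an element of
`𝔤_0' ⊗ 𝔤_0'`. -/
def weylForm (m : ℕ) : soAlg m ⊗[ℝ] soAlg m →ₗ[ℝ]
    ((Fin (m + 2) → ℂ) →ₗ[ℂ] (Fin (m + 2) → ℂ) →ₗ[ℂ] (Fin (m + 2) → ℂ) →ₗ[ℂ]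
      (Fin (m + 2) → ℂ) →ₗ[ℂ] ℂ) where
  toFun w := fourForm (lowered m w)
  map_add' w w' := by
    refine LinearMap.ext fun x => LinearMap.ext₂ fun y z => LinearMap.ext fun t => ?_
    simp only [LinearMap.add_apply, fourForm_apply, map_add, Pi.add_apply, Complex.ofReal_add,
      add_mul, mul_add, Finset.sum_add_distrib]
  map_smul' r w := by
    refine LinearMap.ext fun x => LinearMap.ext₂ fun y z => LinearMap.ext fun t => ?_
    simp only [LinearMap.smul_apply, fourForm_apply, map_smul, Pi.smul_apply, smul_eq_mul,
      Complex.ofReal_mul, Finset.smul_sum, Complex.real_smul, RingHom.id_apply]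
    refine Finset.sum_congr rfl fun a _ => Finset.sum_congr rfl fun b _ =>
      Finset.sum_congr rfl fun c _ => Finset.sum_congr rfl fun d _ => ?_
    ring

theorem weylForm_apply {m : ℕ} (w : soAlg m ⊗[ℝ] soAlg m) (x y z t : Fin (m + 2) → ℂ) :
    weylForm m w x y z t
      = ∑ a, ∑ b, ∑ c, ∑ d, x a * (y b * (z c * ((lowered m w a b c d : ℂ) * t d))) :=
  fourForm_apply _ _ _ _ _

theorem weylForm_single {m : ℕ} (w : soAlg m ⊗[ℝ] soAlg m) (a b c d : Fin (m + 2)) :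
    weylForm m w (Pi.single a 1) (Pi.single b 1) (Pi.single c 1) (Pi.single d 1)
      = lowered m w a b c d := by
  simp [weylForm_apply, Pi.single_apply]

theorem weylForm_star {m : ℕ} (w : soAlg m ⊗[ℝ] soAlg m) (x y z t : Fin (m + 2) → ℂ) :
    weylForm m w (star x) (star y) (star z) (star t) = star (weylForm m w x y z t) := by
  simp [weylForm_apply]

theorem weylForm_tmul {m : ℕ} (U V : soAlg m) (x y z t : Fin (m + 2) → ℂ) :
    weylForm m (U ⊗ₜ V) x y z t = soForm U x y * soForm V z t := by
  simp only [weylForm_apply, soForm, dotProduct, Matrix.mulVec, Matrix.map_apply]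
  rw [Finset.sum_mul]
  refine Finset.sum_congr rfl fun a _ => ?_
  rw [Finset.mul_sum _ _ (x a), Finset.sum_mul]
  refine Finset.sum_congr rfl fun b _ => ?_
  rw [Finset.mul_sum]
  refine Finset.sum_congr rfl fun c _ => ?_
  rw [Finset.mul_sum, Finset.mul_sum]
  refine Finset.sum_congr rfl fun d _ => ?_
  simp [lowered]
  ring

theorem soForm_skew {m : ℕ} (U : soAlg m) (x y : Fin (m + 2) → ℂ) :
    soForm U x y = -soForm U y x := by
  have h : (minkowski m * soIncl m U)ᵀ = -(minkowski m * soIncl m U) :=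
    (mem_soMatrices _).1 (Subtype.property (p := (· ∈ soMatrices m)) U)
  have h2 : ((minkowski m * soIncl m U).map Complex.ofReal)ᵀ
      = -(minkowski m * soIncl m U).map Complex.ofReal := by
    rw [← Matrix.transpose_map, h]
    ext
    simp
  rw [soForm, soForm, dotProduct_comm x, Matrix.dotProduct_mulVec, ← Matrix.mulVec_transpose, h2,
    Matrix.neg_mulVec, neg_dotProduct, neg_neg]

theorem weylForm_skew {m : ℕ} (w : soAlg m ⊗[ℝ] soAlg m) (x y z t : Fin (m + 2) → ℂ) :
    weylForm m w x y z t = -weylForm m w y x z t := by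
  induction w with
  | zero => simp
  | tmul U V => rw [weylForm_tmul, weylForm_tmul, soForm_skew U x y, neg_mul]
  | add w w' h h' => simp only [map_add, LinearMap.add_apply, h, h', neg_add]

theorem weylForm_comm {m : ℕ} (w : soAlg m ⊗[ℝ] soAlg m) (x y z t : Fin (m + 2) → ℂ) :
    weylForm m (TensorProduct.comm ℝ _ _ w) x y z t = weylForm m w z t x y := by
  induction w with
  | zero => simp
  | tmul U V => rw [TensorProduct.comm_tmul, weylForm_tmul, weylForm_tmul, mul_comm]
  | add w w' h h' => simp only [map_add, LinearMap.add_apply, h, h']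

theorem weylForm_symm {m : ℕ} (w : symSq m) (x y z t : Fin (m + 2) → ℂ) :
    weylForm m w x y z t = weylForm m w z t x y := by
  rw [← weylForm_comm, (mem_symTensors _).1 w.2]

/-- The action of `g⁻¹` on complexified Minkowski space. -/
def invAct {m : ℕ} (g : conformalGroup m) : (Fin (m + 2) → ℂ) →ₗ[ℂ] (Fin (m + 2) → ℂ) :=
  Matrix.mulVecLin ((confMatrix g⁻¹).map Complex.ofReal)

theorem dotProduct_invAct {m : ℕ} (g : conformalGroup m)
    (M : Matrix (Fin (m + 2)) (Fin (m + 2)) ℝ) (x y : Fin (m + 2) → ℂ) :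
    invAct g x ⬝ᵥ M.map Complex.ofReal *ᵥ invAct g y
      = x ⬝ᵥ ((confMatrix g⁻¹)ᵀ * M * confMatrix g⁻¹).map Complex.ofReal *ᵥ y := by
  have h : ((confMatrix g⁻¹)ᵀ * M * confMatrix g⁻¹).map Complex.ofReal
      = ((confMatrix g⁻¹).map Complex.ofReal)ᵀ * M.map Complex.ofReal
        * (confMatrix g⁻¹).map Complex.ofReal := by
    change (_ : Matrix _ _ ℝ).map Complex.ofRealHom = _
    rw [Matrix.map_mul, Matrix.map_mul]
    rfl
  rw [h, invAct, Matrix.mulVecLin_apply, Matrix.mulVecLin_apply, ← Matrix.mulVec_mulVec,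
    ← Matrix.mulVec_mulVec, Matrix.dotProduct_mulVec x, Matrix.vecMul_transpose]

theorem soForm_adRep {m : ℕ} (g : conformalGroup m) (U : soAlg m) (x y : Fin (m + 2) → ℂ) :
    soForm (adRep m g U) x y = conformalFactor g * soForm U (invAct g x) (invAct g y) := by
  have h := minkowski_conjRep g (soIncl m U)
  rw [conjRep_apply, ← soIncl_adRep] at h
  rw [soForm, soForm, dotProduct_invAct, h]
  have h2 : ∀ (c : ℝ) (M : Matrix (Fin (m + 2)) (Fin (m + 2)) ℝ),
      (c • M).map Complex.ofReal = (c : ℂ) • M.map Complex.ofReal := by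
    intro c M
    ext
    simp
  rw [h2, Matrix.smul_mulVec, dotProduct_smul, smul_eq_mul]

/-- Each factor of the symmetric square contributes one conformal factor, and the dilation weight
removes one of the two. The form thus scales like the inner product in `complexMink_invAct`, as the
transport lemmas require. -/
theorem weylForm_weylRep {m : ℕ} (g : conformalGroup m) (w : symSq m)
    (x y z t : Fin (m + 2) → ℂ) :
    weylForm m (weylRep m g w) x y z t = conformalFactor g *
      weylForm m w (invAct g x) (invAct g y) (invAct g z) (invAct g t) := by
  have h : ∀ w : soAlg m ⊗[ℝ] soAlg m,
      weylForm m (TensorProduct.map (adRep m g) (adRep m g) w) x y z t = conformalFactor g ^ 2 *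
        weylForm m w (invAct g x) (invAct g y) (invAct g z) (invAct g t) := by
    intro w
    induction w with
    | zero => simp
    | tmul U V =>
      rw [TensorProduct.map_tmul, weylForm_tmul, weylForm_tmul, soForm_adRep, soForm_adRep]
      ring
    | add w w' h h' => simp only [map_add, LinearMap.add_apply, h, h', mul_add]
  have h1 : ((weylRep m g w : symSq m) : soAlg m ⊗[ℝ] soAlg m)
      = (conformalFactor g)⁻¹ • TensorProduct.map (adRep m g) (adRep m g) w := rfl
  have hc : (conformalFactor g : ℂ) ≠ 0 := by exact_mod_cast (conformalFactor_pos g).ne'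
  rw [h1, map_smul]
  simp only [LinearMap.smul_apply, h, Complex.real_smul, Complex.ofReal_inv]
  field_simp

theorem complexMink_invAct {m : ℕ} (g : conformalGroup m) (x y : Fin (m + 2) → ℂ) :
    complexMink m x y = conformalFactor g * complexMink m (invAct g x) (invAct g y) := by
  have h := minkowski_conjRep g 1
  have h1 : conjRep m g 1 = 1 := by rw [conjRep_apply, mul_one, confMatrix_mul_inv]
  rw [h1, mul_one] at h
  rw [complexMink_apply, complexMink_apply, dotProduct_invAct]
  conv_lhs => rw [h]
  have h2 : ∀ (c : ℝ) (M : Matrix (Fin (m + 2)) (Fin (m + 2)) ℝ),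
      (c • M).map Complex.ofReal = (c : ℂ) • M.map Complex.ofReal := by
    intro c M
    ext
    simp
  rw [h2, Matrix.smul_mulVec, dotProduct_smul, smul_eq_mul]

theorem minkowski_mul_self (m : ℕ) : minkowski m * minkowski m = 1 := by
  ext i j
  simp only [Matrix.mul_apply, minkowski, Matrix.of_apply, ite_mul, one_mul, zero_mul,
    Finset.sum_ite_eq', Finset.mem_univ, if_true, Equiv.swap_apply_self,
    Matrix.one_apply, eq_comm]

/-- Lowering an index is injective on the Lie algebra, and over a field its tensor square remains
injective; `lowered` lists the coordinates of that square in the standard basis. -/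
theorem lowered_injective (m : ℕ) : Function.Injective (lowered m) := by
  let f : soAlg m →ₗ[ℝ] Matrix (Fin (m + 2)) (Fin (m + 2)) ℝ :=
    LinearMap.mulLeft ℝ (minkowski m) ∘ₗ soIncl m
  have hf : Function.Injective f := by
    intro U V h
    have h1 := congrArg (minkowski m * ·) h
    simp only [f, LinearMap.comp_apply, LinearMap.mulLeft_apply, ← mul_assoc, minkowski_mul_self,
      one_mul] at h1
    exact Subtype.ext h1
  let B := (Matrix.stdBasis ℝ (Fin (m + 2)) (Fin (m + 2))).tensorProduct
    (Matrix.stdBasis ℝ (Fin (m + 2)) (Fin (m + 2)))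
  have hB : ∀ (w : soAlg m ⊗[ℝ] soAlg m) (a b c d),
      B.repr (TensorProduct.map f f w) ((a, b), (c, d)) = lowered m w a b c d := by
    intro w a b c d
    induction w with
    | zero => simp
    | tmul U V =>
      simp [B, lowered, f, Module.Basis.tensorProduct_repr_tmul_apply, Matrix.stdBasis, mul_comm]
    | add w w' h h' =>
      simp only [map_add, Finsupp.add_apply, Pi.add_apply, h, h']
  rw [injective_iff_map_eq_zero]
  intro w hw
  have h0 : TensorProduct.map f f w = 0 := by
    refine (LinearEquiv.map_eq_zero_iff B.repr).1 (Finsupp.ext ?_)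
    rintro ⟨⟨a, b⟩, c, d⟩
    rw [hB, hw]
    rfl
  have hinj : Function.Injective (TensorProduct.map f f) :=
    TensorProduct.map_injective_of_flat_flat f f hf hf
  exact hinj (by rw [h0, map_zero])

/-! ### The elements of positive weight along the first basis vector -/

theorem midIdx_ne_zero {m : ℕ} (i : Fin m) : midIdx i ≠ 0 := by simp [midIdx, Fin.ext_iff]

theorem midIdx_ne_last {m : ℕ} (i : Fin m) : midIdx i ≠ Fin.last (m + 1) :=
  (Fin.castSucc_lt_last _).ne

theorem midIdx_inj {m : ℕ} {i j : Fin m} : midIdx i = midIdx j ↔ i = j := by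
  simp [midIdx]

theorem fin_cases_mid {m : ℕ} {p : Fin (m + 2) → Prop} (h0 : p 0) (h1 : ∀ i, p (midIdx i))
    (h2 : p (Fin.last (m + 1))) (i : Fin (m + 2)) : p i := by
  induction i using Fin.lastCases with
  | last => exact h2
  | cast i =>
    induction i using Fin.cases with
    | zero => exact h0
    | succ i => exact h1 i

theorem dotProduct_minkowski_single {m : ℕ} (a b c d : Fin (m + 2)) (x y : Fin (m + 2) → ℂ) :
    x ⬝ᵥ (minkowski m * (Matrix.single a b 1 - Matrix.single c d 1)).map Complex.ofReal *ᵥ y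
      = x (Equiv.swap 0 (Fin.last (m + 1)) a) * y b
        - x (Equiv.swap 0 (Fin.last (m + 1)) c) * y d := by
  have h : (minkowski m * (Matrix.single a b 1 - Matrix.single c d 1)).map Complex.ofReal
      = Matrix.single (Equiv.swap 0 (Fin.last (m + 1)) a) b (1 : ℂ)
        - Matrix.single (Equiv.swap 0 (Fin.last (m + 1)) c) d 1 := by
    rw [mul_sub, minkowski_mul_single, minkowski_mul_single]
    ext i j
    simp [Matrix.single_apply, apply_ite Complex.ofReal]
  rw [h, Matrix.sub_mulVec, dotProduct_sub]
  have h2 : ∀ i j : Fin (m + 2), x ⬝ᵥ Matrix.single i j 1 *ᵥ y = x i * y j := by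
    intro i j
    simp only [dotProduct, Matrix.mulVec, Matrix.single_apply, ite_and, ite_mul, one_mul,
      zero_mul]
    simp [Finset.sum_ite_eq]
  rw [h2, h2]

theorem soForm_elemU {m : ℕ} (i : Fin m) (x y : Fin (m + 2) → ℂ) :
    soForm (elemU i) x y
      = x (Fin.last (m + 1)) * y (midIdx i) - x (midIdx i) * y (Fin.last (m + 1)) := by
  have h := dotProduct_minkowski_single 0 (midIdx i) (midIdx i) (Fin.last (m + 1)) x y
  rwa [Equiv.swap_apply_left, swap_midIdx] at h

theorem soForm_elemB {m : ℕ} (x y : Fin (m + 2) → ℂ) :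
    soForm (elemB m) x y = x (Fin.last (m + 1)) * y 0 - x 0 * y (Fin.last (m + 1)) := by
  have h := dotProduct_minkowski_single 0 0 (Fin.last (m + 1)) (Fin.last (m + 1)) x y
  rwa [Equiv.swap_apply_left, Equiv.swap_apply_right] at h

theorem soForm_elemR {m : ℕ} (j k : Fin m) (x y : Fin (m + 2) → ℂ) :
    soForm (elemR j k) x y = x (midIdx j) * y (midIdx k) - x (midIdx k) * y (midIdx j) := by
  have h := dotProduct_minkowski_single (midIdx j) (midIdx k) (midIdx k) (midIdx j) x y
  rwa [swap_midIdx, swap_midIdx] at h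

theorem weylForm_symProd {m : ℕ} (U V : soAlg m) (x y z t : Fin (m + 2) → ℂ) :
    weylForm m (symProd U V) x y z t
      = 2⁻¹ * (soForm U x y * soForm V z t + soForm V x y * soForm U z t) := by
  simp only [symProd, map_smul, map_add, LinearMap.smul_apply, LinearMap.add_apply, weylForm_tmul,
    Complex.real_smul]
  norm_num

theorem complexMink_single_zero {m : ℕ} (x : Fin (m + 2) → ℂ) :
    complexMink m (Pi.single 0 1) x = x (Fin.last (m + 1)) := by
  simp [complexMink_eq, midIdx_ne_zero]

/-- The hypothesis says that E_1 is an eigenvector of V, of eigenvalue -c, so V has weight at least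
zero. The factor `elemU i` has weight one: it kills E_1, and its form vanishes on bivectors of the
orthogonal complement of E_1. -/
theorem isPosAt_symProd {m : ℕ} (i : Fin m) (V : soAlg m) (c : ℂ)
    (hV : ∀ q, soForm V (Pi.single 0 1) q = c * q (Fin.last (m + 1))) :
    IsPosAt (complexMink m) (weylForm m (symProd (elemU i) V)) (Pi.single 0 1) := by
  have hU : ∀ q, soForm (elemU i) (Pi.single 0 1) q = 0 := by
    intro q
    simp [soForm_elemU, midIdx_ne_zero]
  constructor
  · intro p q z t
    simp only [weylForm_symProd, complexMink_single_zero, hU, hV]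
    ring
  · intro p q
    simp only [weylForm_symProd, hU]
    ring
  · intro p q r s
    simp only [weylForm_symProd, complexMink_single_zero, hU, hV, soForm_elemU]
    ring
  · intro q r s q' r' s'
    simp only [coreForm, contrForm, weylForm_symProd, complexMink_single_zero, soForm_elemU]
    ring

/-- The submodule of the tensors of positive weight along the first basis vector. -/
def posSubmodule (m : ℕ) : Submodule ℝ (symSq m) where
  carrier := {w | IsPosAt (complexMink m) (weylForm m w) (Pi.single 0 1)}
  zero_mem' := by
    change IsPosAt _ (weylForm m 0) _
    rw [map_zero]
    exact isPosAt_zero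
  add_mem' := fun {w w'} h h' => by
    change IsPosAt _ (weylForm m (w + w')) _
    rw [map_add]
    exact h.add h'
  smul_mem' := fun c w h => by
    change IsPosAt _ (weylForm m (c • w)) _
    rw [map_smul]
    exact h.smul (c : ℂ)

theorem positiveElem_mem_posSubmodule {m : ℕ} (α : Fin m → Fin m → ℝ) (β : Fin m → ℝ)
    (γ : Fin m → Fin m → Fin m → ℝ) : positiveElem α β γ ∈ posSubmodule m := by
  refine add_mem (add_mem ?_ ?_) ?_
  · refine sum_mem fun i _ => sum_mem fun j _ => Submodule.smul_mem _ _ ?_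
    refine isPosAt_symProd i _ 0 fun q => ?_
    simp [soForm_elemU, midIdx_ne_zero]
  · refine sum_mem fun i _ => Submodule.smul_mem _ _ ?_
    refine isPosAt_symProd i _ (-1) fun q => ?_
    simp [soForm_elemB]
  · refine sum_mem fun i _ => sum_mem fun j _ => sum_mem fun k _ => Submodule.smul_mem _ _ ?_
    refine isPosAt_symProd i _ 0 fun q => ?_
    simp [soForm_elemR, midIdx_ne_zero]

theorem weylForm_positiveElem {m : ℕ} (α : Fin m → Fin m → ℝ) (β : Fin m → ℝ)
    (γ : Fin m → Fin m → Fin m → ℝ) (x y z t : Fin (m + 2) → ℂ) :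
    weylForm m (positiveElem α β γ) x y z t =
      ∑ i, ∑ j, α i j * weylForm m (symProd (elemU i) (elemU j)) x y z t
      + ∑ i, β i * weylForm m (symProd (elemU i) (elemB m)) x y z t
      + ∑ i, ∑ j, ∑ k, γ i j k * weylForm m (symProd (elemU i) (elemR j k)) x y z t := by
  simp only [positiveElem, Submodule.coe_add, Submodule.coe_sum, Submodule.coe_smul, map_add,
    map_sum, map_smul, LinearMap.add_apply, LinearMap.sum_apply, LinearMap.smul_apply,
    Complex.real_smul]

theorem lowered_positiveElem_mid_mid {m : ℕ} {α : Fin m → Fin m → ℝ} (β : Fin m → ℝ)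
    (γ : Fin m → Fin m → Fin m → ℝ) (hα : ∀ i j, α i j = α j i) (i j : Fin m) :
    lowered m (positiveElem α β γ) (Fin.last (m + 1)) (midIdx i) (Fin.last (m + 1)) (midIdx j)
      = α i j := by
  rw [← Complex.ofReal_inj, ← weylForm_single, weylForm_positiveElem]
  simp [weylForm_symProd, soForm_elemU, soForm_elemB, soForm_elemR, Pi.single_apply, midIdx_inj,
    midIdx_ne_last]
  have h := congrArg Complex.ofReal (hα i j)
  simp [(midIdx_ne_zero _).symm, mul_add, Finset.sum_add_distrib]
  linear_combination -2⁻¹ * h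

theorem lowered_positiveElem_mid_zero {m : ℕ} (α : Fin m → Fin m → ℝ) (β : Fin m → ℝ)
    (γ : Fin m → Fin m → Fin m → ℝ) (i : Fin m) :
    lowered m (positiveElem α β γ) (Fin.last (m + 1)) (midIdx i) (Fin.last (m + 1)) 0
      = 2⁻¹ * β i := by
  rw [← Complex.ofReal_inj, ← weylForm_single, weylForm_positiveElem]
  simp [weylForm_symProd, soForm_elemU, soForm_elemB, soForm_elemR, Pi.single_apply, midIdx_inj,
    midIdx_ne_last, midIdx_ne_zero]
  ring

theorem lowered_positiveElem_mid_mid_mid {m : ℕ} (α : Fin m → Fin m → ℝ) (β : Fin m → ℝ)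
    {γ : Fin m → Fin m → Fin m → ℝ} (hγ : ∀ i j k, γ i j k = -γ i k j) (i j k : Fin m) :
    lowered m (positiveElem α β γ) (Fin.last (m + 1)) (midIdx i) (midIdx j) (midIdx k)
      = γ i j k := by
  rw [← Complex.ofReal_inj, ← weylForm_single, weylForm_positiveElem]
  simp [weylForm_symProd, soForm_elemU, soForm_elemB, soForm_elemR, Pi.single_apply, midIdx_inj,
    midIdx_ne_last, midIdx_ne_zero]
  have h := congrArg Complex.ofReal (hγ i j k)
  push_cast at h
  simp [mul_sub, Finset.sum_sub_distrib]
  linear_combination -2⁻¹ * h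

theorem lowered_skew {m : ℕ} (w : soAlg m ⊗[ℝ] soAlg m) (a b c d : Fin (m + 2)) :
    lowered m w a b c d = -lowered m w b a c d := by
  rw [← Complex.ofReal_inj, Complex.ofReal_neg, ← weylForm_single, ← weylForm_single,
    weylForm_skew]

theorem lowered_symm {m : ℕ} (w : symSq m) (a b c d : Fin (m + 2)) :
    lowered m w a b c d = lowered m w c d a b := by
  rw [← Complex.ofReal_inj, ← weylForm_single, ← weylForm_single, weylForm_symm]

theorem skew_array_eq_zero {m : ℕ} {f : Fin (m + 2) → Fin (m + 2) → ℝ}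
    (hf : ∀ a b, f a b = -f b a) (h0 : ∀ i, f 0 (midIdx i) = 0)
    (h1 : f (Fin.last (m + 1)) 0 = 0) (h2 : ∀ i j, f (midIdx i) (midIdx j) = 0)
    (h3 : ∀ i, f (Fin.last (m + 1)) (midIdx i) = 0) (a b : Fin (m + 2)) : f a b = 0 := by
  have hd : ∀ a, f a a = 0 := fun a => by linarith [hf a a]
  revert a b
  refine fin_cases_mid (fin_cases_mid (hd _) h0 ?_) (fun i => fin_cases_mid ?_ (h2 i) ?_)
    (fin_cases_mid h1 h3 (hd _))
  · rw [hf, h1, neg_zero]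
  · rw [hf, h0, neg_zero]
  · rw [hf, h3, neg_zero]

/-- A tensor of positive weight along the first basis vector is determined by its components of
weight one and two. -/
theorem eq_zero_of_isPosAt_single {m : ℕ} {w : symSq m}
    (hw : IsPosAt (complexMink m) (weylForm m w) (Pi.single 0 1))
    (h1 : ∀ i j, lowered m w (Fin.last (m + 1)) (midIdx i) (Fin.last (m + 1)) (midIdx j) = 0)
    (h2 : ∀ i, lowered m w (Fin.last (m + 1)) (midIdx i) (Fin.last (m + 1)) 0 = 0)
    (h3 : ∀ i j k, lowered m w (Fin.last (m + 1)) (midIdx i) (midIdx j) (midIdx k) = 0) :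
    w = 0 := by
  -- Here and in the next three claims the conditions along E_1 are tested on basis vectors, to kill
  -- all components of weight at most zero; inserting E_n supplies the nonzero product with E_1.
  have hleft : ∀ i c d, lowered m w 0 (midIdx i) c d = 0 := by
    intro i c d
    rw [← Complex.ofReal_inj, ← weylForm_single]
    have h := hw.left (Pi.single (midIdx i) 1) (Pi.single (Fin.last (m + 1)) 1) (Pi.single c 1)
      (Pi.single d 1)
    simpa [complexMink_single_zero, Pi.single_apply, (midIdx_ne_last i).symm] using h
  have hdiag : lowered m w (Fin.last (m + 1)) 0 (Fin.last (m + 1)) 0 = 0 := by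
    rw [lowered_skew, lowered_symm, lowered_skew, ← Complex.ofReal_inj, neg_neg,
      ← weylForm_single, hw.diag, Complex.ofReal_zero]
  have hmixed : ∀ i j, lowered m w (Fin.last (m + 1)) 0 (midIdx i) (midIdx j) = 0 := by
    intro i j
    rw [lowered_skew, neg_eq_zero, ← Complex.ofReal_inj, ← weylForm_single]
    have h := hw.mixed (Pi.single (Fin.last (m + 1)) 1) (Pi.single (Fin.last (m + 1)) 1)
      (Pi.single (midIdx i) 1) (Pi.single (midIdx j) 1)
    simpa [complexMink_single_zero, Pi.single_apply, (midIdx_ne_last _).symm] using h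
  have hcore : ∀ i j k l, lowered m w (midIdx i) (midIdx j) (midIdx k) (midIdx l) = 0 := by
    intro i j k l
    rw [← Complex.ofReal_inj, ← weylForm_single]
    have h := hw.core (Pi.single (Fin.last (m + 1)) 1) (Pi.single (midIdx i) 1)
      (Pi.single (midIdx j) 1) (Pi.single (Fin.last (m + 1)) 1) (Pi.single (midIdx k) 1)
      (Pi.single (midIdx l) 1)
    simpa [coreForm, contrForm, complexMink_single_zero, Pi.single_apply,
      (midIdx_ne_last _).symm] using h
  apply Subtype.ext
  apply lowered_injective m
  rw [ZeroMemClass.coe_zero, map_zero]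
  funext a b c d
  refine skew_array_eq_zero (f := fun a b => lowered m w a b c d)
    (fun a b => lowered_skew _ _ _ _ _) (fun i => hleft i c d) ?_ (fun i j => ?_) (fun i => ?_) a b
  all_goals
    rw [lowered_symm]
    refine skew_array_eq_zero (f := fun c d => lowered m w c d _ _)
      (fun a b => lowered_skew _ _ _ _ _) (fun i => hleft i _ _) ?_ (fun i j => ?_) (fun i => ?_)
      c d
    all_goals first
      | exact hdiag | exact hmixed _ _ | exact hcore _ _ _ _ | exact h1 _ _ | exact h2 _
      | exact h3 _ _ _ | (rw [lowered_symm]; first | exact hmixed _ _ | exact h2 _ | exact h3 _ _ _)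

/-- The coefficients are read off the components of weight one and two. Subtracting the resulting
`positiveElem` leaves a positive tensor without such components, which vanishes by
`eq_zero_of_isPosAt_single`. -/
theorem exists_positiveElem_iff {m : ℕ} (w : symSq m) :
    (∃ α β γ, (∀ i j, α i j = α j i) ∧ (∀ i j k, γ i j k = -γ i k j) ∧ w = positiveElem α β γ) ↔
      IsPosAt (complexMink m) (weylForm m w) (Pi.single 0 1) := by
  constructor
  · rintro ⟨α, β, γ, -, -, h⟩
    exact h ▸ positiveElem_mem_posSubmodule α β γ
  · intro hw
    let α : Fin m → Fin m → ℝ := fun i j =>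
      lowered m w (Fin.last (m + 1)) (midIdx i) (Fin.last (m + 1)) (midIdx j)
    -- The factor 2 undoes the 1/2 in `symProd`, of which only one of the two summands is seen here.
    -- For α and γ both (i, j) and (j, i), respectively (j, k) and (k, j), contribute.
    let β : Fin m → ℝ := fun i =>
      2 * lowered m w (Fin.last (m + 1)) (midIdx i) (Fin.last (m + 1)) 0
    let γ : Fin m → Fin m → Fin m → ℝ := fun i j k =>
      lowered m w (Fin.last (m + 1)) (midIdx i) (midIdx j) (midIdx k)
    have hα : ∀ i j, α i j = α j i := fun i j => lowered_symm _ _ _ _ _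
    have hγ : ∀ i j k, γ i j k = -γ i k j := fun i j k => by
      simp only [γ]
      rw [lowered_symm, lowered_skew, lowered_symm]
    refine ⟨α, β, γ, hα, hγ, sub_eq_zero.1 (eq_zero_of_isPosAt_single ?_ ?_ ?_ ?_)⟩
    · exact sub_mem (S := Submodule ℝ (symSq m)) hw (positiveElem_mem_posSubmodule α β γ)
    · intro i j
      rw [Submodule.coe_sub, map_sub]
      simp only [Pi.sub_apply]
      rw [lowered_positiveElem_mid_mid β γ hα, sub_self]
    · intro i
      rw [Submodule.coe_sub, map_sub]
      simp only [Pi.sub_apply]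
      rw [lowered_positiveElem_mid_zero]
      simp [β]
    · intro i j k
      rw [Submodule.coe_sub, map_sub]
      simp only [Pi.sub_apply]
      rw [lowered_positiveElem_mid_mid_mid α β hγ, sub_self]

/-- The elements U_i^+ and R_{jk} kill E_1 while B does not, so the β_i are the only obstruction to
E_1 annihilating the tensor. -/
theorem exists_positiveElem_of_beta_iff {m : ℕ} (w : symSq m) :
    (∃ α β γ, (∀ i j, α i j = α j i) ∧ (∀ i j k, γ i j k = -γ i k j) ∧ w = positiveElem α β γ ∧
      ∀ i, β i = 0) ↔ IsNullAt (complexMink m) (weylForm m w) (Pi.single 0 1) := by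
  constructor
  · rintro ⟨α, β, γ, -, -, h, hβ⟩
    refine ⟨fun p z t => ?_, (h ▸ positiveElem_mem_posSubmodule α β γ : w ∈ posSubmodule m).core⟩
    simp [h, weylForm_positiveElem, hβ, weylForm_symProd, soForm_elemU, soForm_elemR,
      midIdx_ne_zero]
  · intro hw
    obtain ⟨α, β, γ, hα, hγ, h⟩ := (exists_positiveElem_iff w).2 hw.isPosAt
    refine ⟨α, β, γ, hα, hγ, h, fun i => ?_⟩
    have h1 := lowered_positiveElem_mid_zero α β γ i
    rw [← h, lowered_symm, lowered_skew, ← Complex.ofReal_inj, Complex.ofReal_neg,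
      ← weylForm_single, hw.left] at h1
    simpa using h1.symm

/-! ### Invariant submodules -/

theorem Submodule.isZariskiClosed {W : Type*} [AddCommGroup W] [Module ℝ W] (p : Submodule ℝ W) :
    IsZariskiClosed (p : Set W) := by
  convert isZariskiClosed_of_forall (fun (f : {f : W →ₗ[ℝ] ℝ // p ≤ LinearMap.ker f}) w => f.1 w)
    (fun f => dual_mem_polyFunctions f.1) using 1
  ext w
  refine ⟨fun hw f => f.2 hw, fun h => ?_⟩
  by_contra hw
  obtain ⟨f, hf, hpf⟩ := p.exists_le_ker_of_notMem hw
  exact hf (h ⟨f, hpf⟩)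

/-- An invariant condition may be imposed after forming the orbit; this is how the Ricci and Bianchi
conditions are split off. -/
theorem orbitSet_inter {G W : Type*} [Group G] [AddCommGroup W] [Module ℝ W]
    (ρ : Representation ℝ G W) (S P : Set W) (hP : ∀ g, ∀ w ∈ P, ρ g w ∈ P) :
    orbitSet ρ (S ∩ P) = orbitSet ρ S ∩ P := by
  ext w
  constructor
  · rintro ⟨g, v, ⟨hv, hv'⟩, rfl⟩
    exact ⟨⟨g, v, hv, rfl⟩, hP g v hv'⟩
  · rintro ⟨⟨g, v, hv, rfl⟩, h⟩
    have := hP g⁻¹ _ h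
    rw [Representation.inv_self_apply] at this
    exact ⟨g, v, ⟨hv, this⟩, rfl⟩

theorem ricciMap_weylRep {m : ℕ} (g : conformalGroup m) (w : symSq m) :
    ricciMap m (weylRep m g w)
      = (conformalFactor g)⁻¹ • (confMatrix g * ricciMap m w * confMatrix g⁻¹) := by
  have hg : confMatrix g⁻¹ * confMatrix g = 1 := by
    simpa using confMatrix_mul_inv g⁻¹
  have h : ∀ w : soAlg m ⊗[ℝ] soAlg m,
      LinearMap.mul' ℝ _ (TensorProduct.map (soIncl m) (soIncl m)
        (TensorProduct.map (adRep m g) (adRep m g) w))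
      = confMatrix g * LinearMap.mul' ℝ _ (TensorProduct.map (soIncl m) (soIncl m) w)
        * confMatrix g⁻¹ := by
    intro w
    induction w with
    | zero => simp
    | tmul U V =>
      simp only [TensorProduct.map_tmul, LinearMap.mul'_apply, soIncl_adRep]
      calc _ = confMatrix g * soIncl m U * (confMatrix g⁻¹ * confMatrix g) * soIncl m V
            * confMatrix g⁻¹ := by simp only [Matrix.mul_assoc]
        _ = _ := by rw [hg, Matrix.mul_one]; simp only [Matrix.mul_assoc]
    | add w w' h h' => simp only [map_add, h, h', Matrix.mul_add, Matrix.add_mul]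
  have h1 : ((weylRep m g w : symSq m) : soAlg m ⊗[ℝ] soAlg m)
      = (conformalFactor g)⁻¹ • TensorProduct.map (adRep m g) (adRep m g) w := rfl
  simp only [ricciMap, LinearMap.comp_apply, Submodule.subtype_apply, h1, map_smul, h]

theorem fourForm_rotate {n : Type*} [Fintype n] (f : n → n → n → n → ℝ) (x y z t : n → ℂ) :
    fourForm f y z x t = fourForm (fun a b c d => f b c a d) x y z t := by
  rw [fourForm_apply, fourForm_apply]
  conv_rhs => rw [Finset.sum_comm]
  refine Finset.sum_congr rfl fun b _ => ?_
  conv_rhs => rw [Finset.sum_comm]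
  refine Finset.sum_congr rfl fun c _ => Finset.sum_congr rfl fun a _ =>
    Finset.sum_congr rfl fun d _ => ?_
  ring

/-- In multilinear form the identity is transported by `invAct` without coordinates, hence is
invariant. -/
theorem bianchi_iff {m : ℕ} (w : soAlg m ⊗[ℝ] soAlg m) :
    (∀ a b c d, lowered m w a b c d + lowered m w b c a d + lowered m w c a b d = 0) ↔
      ∀ x y z t, weylForm m w x y z t + weylForm m w y z x t + weylForm m w z x y t = 0 := by
  constructor
  · intro h x y z t
    have h1 : weylForm m w y z x t = _ := fourForm_rotate (lowered m w) x y z t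
    have h2 : weylForm m w z x y t = _ := fourForm_rotate (lowered m w) y z x t
    rw [fourForm_rotate] at h2
    rw [h1, h2, weylForm_apply, fourForm_apply, fourForm_apply, ← Finset.sum_add_distrib,
      ← Finset.sum_add_distrib]
    refine Finset.sum_eq_zero fun a _ => ?_
    rw [← Finset.sum_add_distrib, ← Finset.sum_add_distrib]
    refine Finset.sum_eq_zero fun b _ => ?_
    rw [← Finset.sum_add_distrib, ← Finset.sum_add_distrib]
    refine Finset.sum_eq_zero fun c _ => ?_
    rw [← Finset.sum_add_distrib, ← Finset.sum_add_distrib]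
    refine Finset.sum_eq_zero fun d _ => ?_
    have h3 := congrArg Complex.ofReal (h a b c d)
    push_cast at h3
    linear_combination x a * y b * z c * t d * h3
  · intro h a b c d
    rw [← Complex.ofReal_inj]
    push_cast
    simp only [← weylForm_single]
    exact h _ _ _ _

theorem weylRep_mem_weylTensors {m : ℕ} (g : conformalGroup m) (w : symSq m)
    (hw : w ∈ weylTensors m) : weylRep m g w ∈ weylTensors m := by
  refine ⟨by rw [ricciMap_weylRep, hw.1]; simp, ?_⟩
  rw [bianchi_iff]
  intro x y z t
  simp only [weylForm_weylRep]
  linear_combination (conformalFactor g : ℂ) *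
    (bianchi_iff _).1 hw.2 (invAct g x) (invAct g y) (invAct g z) (invAct g t)

/-! ### Null vectors -/

theorem exists_conformal_of_null {m : ℕ} {x : Fin (m + 2) → ℝ}
    (hx : x ⬝ᵥ minkowski m *ᵥ x = 0) :
    ∃ (g : conformalGroup m) (c : ℝ), x = c • confMatrix g *ᵥ Pi.single 0 1 := by
  have hI : ∀ (y : Fin (m + 2) → ℝ) i, (minkowski m *ᵥ y) i
      = y (Equiv.swap 0 (Fin.last (m + 1)) i) := fun y i => minkowski_mulVec (RingHom.id ℝ) y i
  have hsymm : ∀ y z : Fin (m + 2) → ℝ, y ⬝ᵥ minkowski m *ᵥ z = z ⬝ᵥ minkowski m *ᵥ y := by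
    intro y z
    rw [dotProduct_comm y, Matrix.dotProduct_mulVec z, ← Matrix.mulVec_transpose,
      minkowski_transpose]
  set e : Fin (m + 2) → ℝ := Pi.single 0 1 with he
  have hex : e ⬝ᵥ minkowski m *ᵥ x = x (Fin.last (m + 1)) := by simp [he, hI]
  have hee : e ⬝ᵥ minkowski m *ᵥ e = 0 := by
    rw [he, single_dotProduct, hI]
    simp
  -- A null vector orthogonal to E_1 is a multiple of E_1, the multiple being zero when x = 0.
  by_cases hl : x (Fin.last (m + 1)) = 0
  · refine ⟨1, x 0, ?_⟩
    have hm : ∀ i, x (midIdx i) = 0 := by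
      have h1 : ∑ i : Fin m, x (midIdx i) * x (midIdx i) = 0 := by
        rw [dotProduct, sum_fin_split] at hx
        simpa [hI, hl, swap_midIdx] using hx
      intro i
      rw [Finset.sum_eq_zero_iff_of_nonneg fun i _ => mul_self_nonneg _] at h1
      exact mul_self_eq_zero.1 (h1 i (Finset.mem_univ _))
    funext i
    revert i
    refine fin_cases_mid ?_ (fun i => ?_) ?_
    · simp [he, confMatrix]
    · rw [hm]
      simp [he, confMatrix, midIdx_ne_zero]
    · rw [hl]
      simp [he, confMatrix]
  -- Two null vectors with nonzero product are exchanged by the reflection `R` in their difference,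
  -- which is not null.
  · set u := e - x with hu
    set N := u ⬝ᵥ minkowski m *ᵥ u with hN
    have hN' : N = -2 * x (Fin.last (m + 1)) := by
      rw [hN, hu]
      simp only [Matrix.mulVec_sub, sub_dotProduct, dotProduct_sub, hee, hx, hex, hsymm x e]
      ring
    have hN0 : N ≠ 0 := by rw [hN']; simpa using hl
    set R : Matrix (Fin (m + 2)) (Fin (m + 2)) ℝ :=
      1 - (2 / N) • Matrix.vecMulVec u (minkowski m *ᵥ u) with hR
    have hRv : ∀ y, R *ᵥ y = y - (2 / N * (u ⬝ᵥ minkowski m *ᵥ y)) • u := by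
      intro y
      rw [hR, Matrix.sub_mulVec, Matrix.one_mulVec, Matrix.smul_mulVec, Matrix.vecMulVec_mulVec,
        hsymm u y, dotProduct_comm y]
      ext i
      simp
      ring
    have hRR : R * R = 1 := by
      refine Matrix.ext_of_mulVec_single fun i => ?_
      rw [← Matrix.mulVec_mulVec, Matrix.one_mulVec, hRv, hRv]
      simp only [Matrix.mulVec_sub, Matrix.mulVec_smul, dotProduct_sub, dotProduct_smul, ← hN,
        smul_eq_mul]
      ext j
      simp only [Pi.sub_apply, Pi.smul_apply, smul_eq_mul]
      field_simp
      ring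
    have hIR : (minkowski m * R)ᵀ = minkowski m * R := by
      rw [hR, mul_sub, mul_one, Matrix.mul_smul, Matrix.mul_vecMulVec, Matrix.transpose_sub,
        Matrix.transpose_smul, Matrix.transpose_vecMulVec, minkowski_transpose]
    let g : conformalGroup m := ⟨⟨R, R, hRR, hRR⟩, 1, one_pos, by
      change Rᵀ * minkowski m * R = _
      rw [Matrix.transpose_mul, minkowski_transpose] at hIR
      rw [hIR, mul_assoc, hRR, mul_one, one_smul]⟩
    refine ⟨g, 1, ?_⟩
    change x = (1 : ℝ) • R *ᵥ e
    have hue : u ⬝ᵥ minkowski m *ᵥ e = -x (Fin.last (m + 1)) := by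
      rw [hu, sub_dotProduct, hee, hsymm x e, hex, zero_sub]
    have : 2 / N * -x (Fin.last (m + 1)) = 1 := by
      rw [hN']
      field_simp
    rw [one_smul, hRv, hue, this, one_smul, hu, sub_sub_cancel]

theorem invAct_inv_single {m : ℕ} (g : conformalGroup m) (y : Fin (m + 2) → ℝ) :
    invAct g⁻¹ (realVec y) = realVec (confMatrix g *ᵥ y) := by
  funext i
  simp [invAct, realVec, Matrix.mulVec, dotProduct]

theorem invAct_invAct_inv {m : ℕ} (g : conformalGroup m) (y : Fin (m + 2) → ℂ) :
    invAct g (invAct g⁻¹ y) = y := by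
  have hg : confMatrix g⁻¹ * confMatrix g = 1 := by
    simpa using confMatrix_mul_inv g⁻¹
  have : (confMatrix g⁻¹).map Complex.ofReal * (confMatrix g).map Complex.ofReal = 1 := by
    change (confMatrix g⁻¹).map Complex.ofRealHom * (confMatrix g).map Complex.ofRealHom = 1
    rw [← Matrix.map_mul, hg]
    simp
  rw [invAct, invAct, inv_inv, Matrix.mulVecLin_apply, Matrix.mulVecLin_apply,
    Matrix.mulVec_mulVec, this, Matrix.one_mulVec]

/-! ### Complex conjugation, and the orbit described by complex null vectors. -/

theorem complexMink_star {m : ℕ} (x y : Fin (m + 2) → ℂ) :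
    complexMink m (star x) (star y) = star (complexMink m x y) := by
  simp [complexMink_eq]

theorem complexMink_realVec {m : ℕ} (x : Fin (m + 2) → ℝ) :
    complexMink m (realVec x) (realVec x) = (x ⬝ᵥ minkowski m *ᵥ x : ℝ) := by
  simp [complexMink_apply, dotProduct, Matrix.mulVec, realVec]

theorem IsPosAt.star {m : ℕ} {w : soAlg m ⊗[ℝ] soAlg m} {v : Fin (m + 2) → ℂ}
    (h : IsPosAt (complexMink m) (weylForm m w) v) :
    IsPosAt (complexMink m) (weylForm m w) (star v) := by
  have hb : ∀ q, complexMink m (Star.star v) q = Star.star (complexMink m v (Star.star q)) :=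
    fun q => by rw [← complexMink_star, star_star]
  have hT : ∀ x y z t, weylForm m w x y z t = Star.star
      (weylForm m w (Star.star x) (Star.star y) (Star.star z) (Star.star t)) :=
    fun x y z t => by simp only [← weylForm_star, star_star]
  constructor
  · intro p q z t
    rw [hb, hb, hT, hT _ q, ← star_mul', ← star_mul', ← star_sub, star_star, h.left, star_zero]
  · intro p q
    rw [hT, star_star, h.diag, star_zero]
  · intro p q r s
    rw [hb, hb, hb, hT _ _ r, hT _ _ s, hT _ _ q, ← star_mul', ← star_mul', ← star_mul',
      ← star_add, ← star_add, star_star, h.mixed, star_zero]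
  · intro q r s q' r' s'
    have h1 := congrArg Star.star (h.core (Star.star q) (Star.star r) (Star.star s) (Star.star q')
      (Star.star r') (Star.star s'))
    simp only [coreForm, contrForm, star_add, star_mul', ← complexMink_star, ← weylForm_star,
      star_star, star_zero] at h1 ⊢
    exact h1

/-- The orbit of the tensors satisfying a positivity condition along the first basis vector
consists of the tensors satisfying it along some complex null vector. -/
theorem mem_orbitSet_iff_exists_null {m : ℕ}
    (Q : ((Fin (m + 2) → ℂ) →ₗ[ℂ] (Fin (m + 2) → ℂ) →ₗ[ℂ] (Fin (m + 2) → ℂ) →ₗ[ℂ]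
      (Fin (m + 2) → ℂ) →ₗ[ℂ] ℂ) → (Fin (m + 2) → ℂ) → Prop)
    (hQ : ∀ T v, Q T v → IsPosAt (complexMink m) T v) (hQ0 : ∀ v, Q 0 v)
    (hsmul : ∀ T v (c : ℂ), c ≠ 0 → Q T (c • v) → Q T v)
    (hact : ∀ (g : conformalGroup m) (w : symSq m) v, Q (weylForm m w) (invAct g v) →
      Q (weylForm m (weylRep m g w)) v) (w : symSq m) :
    w ∈ orbitSet (weylRep m) {w : symSq m | Q (weylForm m w) (Pi.single 0 1)} ↔
      ∃ v, v ≠ 0 ∧ complexMink m v v = 0 ∧ Q (weylForm m w) v := by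
  have hreal : realVec (Pi.single 0 1 : Fin (m + 2) → ℝ) = Pi.single 0 1 := by
    funext i
    simp [realVec, Pi.single_apply, apply_ite Complex.ofReal]
  constructor
  · rintro ⟨g, s, hs, rfl⟩
    refine ⟨invAct g⁻¹ (Pi.single 0 1), fun h => ?_, ?_, hact g s _ ?_⟩
    · have := invAct_invAct_inv g (Pi.single 0 1)
      rw [h, map_zero] at this
      simpa using congrFun this 0
    · rw [complexMink_invAct g, invAct_invAct_inv, complexMink_single_zero]
      simp
    · rwa [invAct_invAct_inv]
  · rintro ⟨v, hv, hvv, hw⟩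
    -- Orthogonality to the conjugate makes v a multiple of a real null vector, in the `G_0`-orbit
    -- of E_1 up to scale. Otherwise the tensor is positive along two transversal null vectors, so
    -- it is zero.
    by_cases hs : complexMink m v (star v) = 0
    · obtain ⟨c, x, hc, rfl⟩ := exists_realVec_of_null hv hvv hs
      have hx : x ⬝ᵥ minkowski m *ᵥ x = 0 := by
        simp only [map_smul, LinearMap.smul_apply, smul_eq_mul, mul_eq_zero, hc, false_or,
          complexMink_realVec] at hvv
        exact_mod_cast hvv
      obtain ⟨g, r, rfl⟩ := exists_conformal_of_null hx
      have hr : realVec (r • confMatrix g *ᵥ Pi.single 0 1)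
          = (r : ℂ) • invAct g⁻¹ (Pi.single 0 1) := by
        rw [← hreal, invAct_inv_single]
        funext i
        simp [realVec]
      rw [hr, smul_smul] at hw hv
      have h1 := hsmul _ _ _ (fun h => hv (by rw [h, zero_smul])) hw
      exact ⟨g, weylRep m g⁻¹ w, hact _ _ _ h1, by rw [Representation.self_inv_apply]⟩
    · have h0 : weylForm m w = 0 := (hQ _ _ hw).eq_zero complexMink_comm (weylForm_skew _)
        (weylForm_symm _) (hQ _ _ hw).star hs
      have hw0 : w = 0 := by
        apply Subtype.ext
        apply lowered_injective m
        funext a b c d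
        rw [← Complex.ofReal_inj, ← weylForm_single, h0]
        simp
      refine ⟨1, 0, ?_, by rw [hw0, map_zero]⟩
      change Q (weylForm m 0) _
      rw [map_zero]
      exact hQ0 _

/-! ### Zariski closedness of the orbits of the positive tensors -/

theorem weylForm_mem_complexPolyFunctions {m : ℕ} (x y z t : Fin (m + 2) → ℂ) :
    (fun w : symSq m => weylForm m w x y z t) ∈ complexPolyFunctions (symSq m) :=
  linear_mem_complexPolyFunctions
    { toFun := fun w : symSq m => weylForm m w x y z t
      map_add' := fun w w' => by simp only [Submodule.coe_add, map_add, LinearMap.add_apply]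
      map_smul' := fun c w => by
        simp only [Submodule.coe_smul, map_smul, LinearMap.smul_apply, RingHom.id_apply] }

theorem isFormFamily_complexMink {m : ℕ} (q : Fin (m + 2) → ℂ) :
    IsFormFamily 1 (fun (_ : symSq m) v => complexMink m v q) :=
  isFormFamily_linear (fun _ => (complexMink m).flip q) fun _ => const_mem_complexPolyFunctions _

theorem isFormFamily_complexMink_self {m : ℕ} :
    IsFormFamily 2 (fun (_ : symSq m) v => complexMink m v v) :=
  isFormFamily_bilinear (fun _ => complexMink m) fun _ _ => const_mem_complexPolyFunctions _

theorem isFormFamily_weylForm {m : ℕ} (p z t : Fin (m + 2) → ℂ) :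
    IsFormFamily 1 (fun (w : symSq m) v => weylForm m w v p z t) :=
  isFormFamily_linear
    (fun w : symSq m => (((weylForm m w).flip p).flip z).flip t)
    fun x => weylForm_mem_complexPolyFunctions x p z t

theorem isFormFamily_weylForm_diag {m : ℕ} (p q : Fin (m + 2) → ℂ) :
    IsFormFamily 2 (fun (w : symSq m) v => weylForm m w v p v q) :=
  isFormFamily_bilinear
    (fun w : symSq m => LinearMap.mk₂ ℂ (fun v v' => weylForm m w v p v' q) (by simp) (by simp) (by simp)
      (by simp))
    fun x y => weylForm_mem_complexPolyFunctions x p y q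

theorem isFormFamily_contrForm {m : ℕ} (q r s z t : Fin (m + 2) → ℂ) :
    IsFormFamily 1 (fun (w : symSq m) v => contrForm (complexMink m) (weylForm m w) v q r s z t) := by
  have h : ∀ p r s, IsFormFamily 1 fun (w : symSq m) v =>
      complexMink m v p * weylForm m w r s z t := fun p r s => by
    convert isFormFamily_linear
      (fun w : symSq m => weylForm m w r s z t • (complexMink m).flip p)
      (fun x => mul_mem (weylForm_mem_complexPolyFunctions r s z t)
        (const_mem_complexPolyFunctions (complexMink m x p))) using 3
    simp [mul_comm]
  exact ((h q r s).add (h r s q)).add (h s q r)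

theorem isFormFamily_coreForm {m : ℕ} (q r s q' r' s' : Fin (m + 2) → ℂ) :
    IsFormFamily 2
      (fun (w : symSq m) v => coreForm (complexMink m) (weylForm m w) v q r s q' r' s') :=
  (((isFormFamily_complexMink q').mul (isFormFamily_contrForm q r s r' s')).add
    ((isFormFamily_complexMink r').mul (isFormFamily_contrForm q r s s' q'))).add
    ((isFormFamily_complexMink s').mul (isFormFamily_contrForm q r s q' r'))

theorem isZariskiClosed_exists_isPosAt (m : ℕ) :
    IsZariskiClosed {w : symSq m | ∃ v, v ≠ 0 ∧ complexMink m v v = 0 ∧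
      IsPosAt (complexMink m) (weylForm m w) v} := by
  let V := Fin (m + 2) → ℂ
  -- The null quadric and then the four fields of `IsPosAt`, each indexed by its auxiliary vectors.
  -- All of them are quadratic in v.
  let f : Unit ⊕ (V × V × V × V) ⊕ (V × V) ⊕ (V × V × V × V) ⊕ (V × V × V × V × V × V) →
      symSq m → V → ℂ :=
    Sum.elim (fun _ _ v => complexMink m v v) <|
    Sum.elim (fun x w v => complexMink m v x.2.1 * weylForm m w v x.1 x.2.2.1 x.2.2.2
      - complexMink m v x.1 * weylForm m w v x.2.1 x.2.2.1 x.2.2.2) <|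
    Sum.elim (fun x w v => weylForm m w v x.1 v x.2) <|
    Sum.elim (fun x w v => complexMink m v x.2.1 * weylForm m w v x.1 x.2.2.1 x.2.2.2
      + complexMink m v x.2.2.1 * weylForm m w v x.1 x.2.2.2 x.2.1
      + complexMink m v x.2.2.2 * weylForm m w v x.1 x.2.1 x.2.2.1)
    (fun x w v => coreForm (complexMink m) (weylForm m w) v x.1 x.2.1 x.2.2.1 x.2.2.2.1
      x.2.2.2.2.1 x.2.2.2.2.2)
  have hf : ∀ i, IsFormFamily 2 (f i) := by
    rintro (_ | ⟨p, q, z, t⟩ | ⟨p, q⟩ | ⟨p, q, r, s⟩ | ⟨q, r, s, q', r', s'⟩)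
    · exact isFormFamily_complexMink_self
    · exact ((isFormFamily_complexMink q).mul (isFormFamily_weylForm p z t)).sub
        ((isFormFamily_complexMink p).mul (isFormFamily_weylForm q z t))
    · exact isFormFamily_weylForm_diag p q
    · exact (((isFormFamily_complexMink q).mul (isFormFamily_weylForm p r s)).add
        ((isFormFamily_complexMink r).mul (isFormFamily_weylForm p s q))).add
        ((isFormFamily_complexMink s).mul (isFormFamily_weylForm p q r))
    · exact isFormFamily_coreForm q r s q' r' s'
  convert isZariskiClosed_exists_ne_zero (fun _ => 2) f hf using 1
  ext w
  refine exists_congr fun v => and_congr_right fun _ => ?_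
  constructor
  · rintro ⟨hv, h⟩ (_ | ⟨p, q, z, t⟩ | ⟨p, q⟩ | ⟨p, q, r, s⟩ | ⟨q, r, s, q', r', s'⟩)
    · exact hv
    · exact h.left p q z t
    · exact h.diag p q
    · exact h.mixed p q r s
    · exact h.core q r s q' r' s'
  · intro h
    exact ⟨h (.inl ()), fun p q z t => h (.inr (.inl (p, q, z, t))),
      fun p q => h (.inr (.inr (.inl (p, q)))),
      fun p q r s => h (.inr (.inr (.inr (.inl (p, q, r, s))))),
      fun q r s q' r' s' => h (.inr (.inr (.inr (.inr (q, r, s, q', r', s')))))⟩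

theorem isZariskiClosed_exists_isNullAt (m : ℕ) :
    IsZariskiClosed {w : symSq m | ∃ v, v ≠ 0 ∧ complexMink m v v = 0 ∧
      IsNullAt (complexMink m) (weylForm m w) v} := by
  let V := Fin (m + 2) → ℂ
  let f : Unit ⊕ (V × V × V) ⊕ (V × V × V × V × V × V) → symSq m → V → ℂ :=
    Sum.elim (fun _ _ v => complexMink m v v) <|
    Sum.elim (fun x w v => weylForm m w v x.1 x.2.1 x.2.2)
    (fun x w v => coreForm (complexMink m) (weylForm m w) v x.1 x.2.1 x.2.2.1 x.2.2.2.1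
      x.2.2.2.2.1 x.2.2.2.2.2)
  -- Annihilation by v is linear in v, so the degrees here are 2, 1, 2.
  have hf : ∀ i, IsFormFamily (Sum.elim (fun _ => 2) (Sum.elim (fun _ => 1) fun _ => 2) i)
      (f i) := by
    rintro (_ | ⟨p, z, t⟩ | ⟨q, r, s, q', r', s'⟩)
    · exact isFormFamily_complexMink_self
    · exact isFormFamily_weylForm p z t
    · exact isFormFamily_coreForm q r s q' r' s'
  convert isZariskiClosed_exists_ne_zero _ f hf using 1
  ext w
  refine exists_congr fun v => and_congr_right fun _ => ?_
  constructor
  · rintro ⟨hv, h⟩ (_ | ⟨p, z, t⟩ | ⟨q, r, s, q', r', s'⟩)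
    · exact hv
    · exact h.left p z t
    · exact h.core q r s q' r' s'
  · intro h
    exact ⟨h (.inl ()), fun p z t => h (.inr (.inl (p, z, t))),
      fun q r s q' r' s' => h (.inr (.inr (q, r, s, q', r', s')))⟩

theorem orbitSet_isPosAt {m : ℕ} :
    orbitSet (weylRep m) {w | IsPosAt (complexMink m) (weylForm m w) (Pi.single 0 1)}
      = {w : symSq m | ∃ v, v ≠ 0 ∧ complexMink m v v = 0 ∧
        IsPosAt (complexMink m) (weylForm m w) v} :=
  Set.ext fun w => mem_orbitSet_iff_exists_null (fun T v => IsPosAt (complexMink m) T v)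
    (fun _ _ h => h) (fun _ => isPosAt_zero) (fun _ _ _ hc h => h.of_smul hc)
    (fun g w _ h => h.transport (complexMink_invAct g) (weylForm_weylRep g w)) w

theorem orbitSet_isNullAt {m : ℕ} :
    orbitSet (weylRep m) {w | IsNullAt (complexMink m) (weylForm m w) (Pi.single 0 1)}
      = {w : symSq m | ∃ v, v ≠ 0 ∧ complexMink m v v = 0 ∧
        IsNullAt (complexMink m) (weylForm m w) v} :=
  Set.ext fun w => mem_orbitSet_iff_exists_null (fun T v => IsNullAt (complexMink m) T v)
    (fun _ _ h => h.isPosAt) (fun _ => ⟨by simp, isPosAt_zero.core⟩)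
    (fun _ _ _ hc h => h.of_smul hc)
    (fun g w _ h => h.transport (complexMink_invAct g) (weylForm_weylRep g w)) w

theorem posRic_eq (m : ℕ) : posRic m =
    {w : symSq m | IsPosAt (complexMink m) (weylForm m w) (Pi.single 0 1)}
      ∩ (LinearMap.ker (ricciMap m) : Set (symSq m)) :=
  Set.ext fun w => and_congr_left' (exists_positiveElem_iff w)

theorem posB_eq (m : ℕ) : posB m =
    {w : symSq m | IsNullAt (complexMink m) (weylForm m w) (Pi.single 0 1)}
      ∩ (LinearMap.ker (ricciMap m) : Set (symSq m)) :=
  Set.ext fun w => and_congr_left' (exists_positiveElem_of_beta_iff w)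

theorem weylRep_mem_ker_ricciMap {m : ℕ} (g : conformalGroup m) (w : symSq m)
    (hw : w ∈ LinearMap.ker (ricciMap m)) : weylRep m g w ∈ LinearMap.ker (ricciMap m) := by
  rw [LinearMap.mem_ker] at hw ⊢
  simp [ricciMap_weylRep, hw]

theorem isZariskiClosed_orbitSet_inter {m : ℕ} {S : Set (symSq m)}
    (hS : IsZariskiClosed (orbitSet (weylRep m) S)) :
    IsZariskiClosed (orbitSet (weylRep m) (S ∩ (LinearMap.ker (ricciMap m) : Set (symSq m)))) ∧
    IsZariskiClosed (orbitSet (weylRep m)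
      (S ∩ (LinearMap.ker (ricciMap m) : Set (symSq m)) ∩ weylTensors m)) := by
  rw [orbitSet_inter (weylRep m) _ (weylTensors m : Set (symSq m)) weylRep_mem_weylTensors,
    orbitSet_inter (weylRep m) S (LinearMap.ker (ricciMap m) : Set (symSq m))
      weylRep_mem_ker_ricciMap]
  have h := hS.inter (LinearMap.ker (ricciMap m)).isZariskiClosed
  exact ⟨h, h.inter (weylTensors m).isZariskiClosed⟩

/-! ### The Cotton module -/

theorem dotProduct_minkowski_of_symm {m : ℕ} {X : Matrix (Fin (m + 2)) (Fin (m + 2)) ℝ}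
    (hX : (minkowski m * X)ᵀ = minkowski m * X) (x y : Fin (m + 2) → ℝ) :
    (X *ᵥ x) ⬝ᵥ minkowski m *ᵥ y = x ⬝ᵥ minkowski m *ᵥ (X *ᵥ y) := by
  rw [Matrix.mulVec_mulVec, ← hX, Matrix.transpose_mul, minkowski_transpose,
    ← Matrix.mulVec_mulVec, Matrix.dotProduct_mulVec x, Matrix.vecMul_transpose]

theorem cottonRep_coe (g : conformalGroup 1) (X : cottonModule) :
    (cottonRep g X : Matrix (Fin (1 + 2)) (Fin (1 + 2)) ℝ)
      = (confMatrix g).det⁻¹ • (confMatrix g * X * confMatrix g⁻¹) := by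
  rw [← conjRep_apply]
  rfl

theorem cottonRep_pow (g : conformalGroup 1) (X : cottonModule) (k : ℕ) :
    (cottonRep g X : Matrix (Fin (1 + 2)) (Fin (1 + 2)) ℝ) ^ k
      = ((confMatrix g).det⁻¹) ^ k • (confMatrix g * X ^ k * confMatrix g⁻¹) := by
  have hg : confMatrix g⁻¹ * confMatrix g = 1 := by
    simpa using confMatrix_mul_inv g⁻¹
  rw [cottonRep_coe, smul_pow]
  congr 1
  induction k with
  | zero => simp [confMatrix_mul_inv]
  | succ k ih =>
    rw [pow_succ, ih, pow_succ]
    calc _ = confMatrix g * (X : Matrix (Fin (1 + 2)) (Fin (1 + 2)) ℝ) ^ k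
          * (confMatrix g⁻¹ * confMatrix g) * X * confMatrix g⁻¹ := by
          simp only [Matrix.mul_assoc]
      _ = _ := by rw [hg, Matrix.mul_one]; simp only [Matrix.mul_assoc]

/-- The elements of `𝕌^∼` of positive weight, in coordinates. -/
def cottonPos (a b : ℝ) : Matrix (Fin (1 + 2)) (Fin (1 + 2)) ℝ := !![0, b, a; 0, 0, b; 0, 0, 0]

theorem cottonPos_eq (a b : ℝ) :
    a • Matrix.vecMulVec (vecE 0) (covecXi 0)
      + b • (Matrix.vecMulVec (vecE 0) (covecXi 1) + Matrix.vecMulVec (vecE 1) (covecXi 0))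
      = cottonPos a b := by
  ext i j
  fin_cases i <;> fin_cases j <;>
  simp [cottonPos, Matrix.vecMulVec_apply, vecE, covecXi, minkowski, Equiv.swap_apply_def]

theorem mem_cottonPosTwo {X : cottonModule} :
    X ∈ cottonPosTwo ↔ ∃ a, (X : Matrix (Fin (1 + 2)) (Fin (1 + 2)) ℝ) = cottonPos a 0 := by
  refine Submodule.mem_span_singleton.trans (exists_congr fun a => ?_)
  rw [← cottonPos_eq, zero_smul, add_zero, eq_comm]
  rfl

theorem mem_cottonPosOne {X : cottonModule} :
    X ∈ cottonPosOne ↔ ∃ b, (X : Matrix (Fin (1 + 2)) (Fin (1 + 2)) ℝ) = cottonPos 0 b := by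
  refine Submodule.mem_span_singleton.trans (exists_congr fun a => ?_)
  rw [← cottonPos_eq, zero_smul, zero_add, eq_comm]
  rfl

theorem cottonPos_add (a b a' b' : ℝ) :
    cottonPos a b + cottonPos a' b' = cottonPos (a + a') (b + b') := by
  simp only [← cottonPos_eq, add_smul]
  abel

theorem minkowski_mul_apply {m : ℕ} (X : Matrix (Fin (m + 2)) (Fin (m + 2)) ℝ)
    (i j : Fin (m + 2)) :
    (minkowski m * X) i j = X (Equiv.swap 0 (Fin.last (m + 1)) i) j := by
  simp [Matrix.mul_apply, minkowski]

theorem cottonPos_mem (a b : ℝ) : cottonPos a b ∈ cottonModule := by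
  rw [mem_cottonModule]
  constructor
  · ext i j
    rw [Matrix.transpose_apply, minkowski_mul_apply, minkowski_mul_apply]
    fin_cases i <;> fin_cases j <;> simp [cottonPos, Equiv.swap_apply_def]
  · simp [cottonPos, Matrix.trace, Fin.sum_univ_succ]

theorem mem_cottonPosOne_sup_cottonPosTwo {X : cottonModule} :
    X ∈ cottonPosOne ⊔ cottonPosTwo ↔
      ∃ a b, (X : Matrix (Fin (1 + 2)) (Fin (1 + 2)) ℝ) = cottonPos a b := by
  rw [Submodule.mem_sup]
  constructor
  · rintro ⟨Y, hY, Z, hZ, rfl⟩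
    obtain ⟨b, hb⟩ := mem_cottonPosOne.1 hY
    obtain ⟨a, ha⟩ := mem_cottonPosTwo.1 hZ
    exact ⟨a, b, by rw [Submodule.coe_add, hb, ha, cottonPos_add, zero_add, add_zero]⟩
  · rintro ⟨a, b, h⟩
    refine ⟨⟨cottonPos 0 b, cottonPos_mem _ _⟩, mem_cottonPosOne.2 ⟨b, rfl⟩,
      ⟨cottonPos a 0, cottonPos_mem _ _⟩, mem_cottonPosTwo.2 ⟨a, rfl⟩, Subtype.ext ?_⟩
    rw [Submodule.coe_add, h, cottonPos_add, zero_add, add_zero]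

/-- Once the first column vanishes, symmetry for the inner product clears the last row and equates
the two superdiagonal entries, and the trace condition kills the middle diagonal entry. -/
theorem exists_eq_cottonPos {X : Matrix (Fin (1 + 2)) (Fin (1 + 2)) ℝ} (hX : X ∈ cottonModule)
    (h0 : X *ᵥ Pi.single 0 1 = 0) : ∃ a b, X = cottonPos a b := by
  obtain ⟨hs, ht⟩ := (mem_cottonModule X).1 hX
  have hc : ∀ i, X i 0 = 0 := fun i => by simpa using congrFun h0 i
  have hsymm : ∀ i j, X (Equiv.swap 0 2 i) j = X (Equiv.swap 0 2 j) i := by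
    intro i j
    have h := congrFun (congrFun hs j) i
    rwa [Matrix.transpose_apply, minkowski_mul_apply, minkowski_mul_apply] at h
  have h21 : X 2 1 = X 1 0 := by simpa [Equiv.swap_apply_def] using hsymm 0 1
  have h22 : X 2 2 = X 0 0 := by simpa [Equiv.swap_apply_def] using hsymm 0 2
  have h12 : X 1 2 = X 0 1 := by simpa [Equiv.swap_apply_def] using hsymm 1 2
  rw [hc] at h21 h22
  have h11 : X 1 1 = 0 := by
    rw [Matrix.trace, Fin.sum_univ_three] at ht
    simpa [hc, h22] using ht
  refine ⟨X 0 2, X 0 1, ?_⟩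
  ext i j
  fin_cases i <;> fin_cases j <;> simp [cottonPos, hc, h21, h22, h12, h11]

theorem cottonPos_pow_two (a b : ℝ) : cottonPos a b ^ 2 = cottonPos (b ^ 2) 0 := by
  rw [pow_two]
  ext i j
  fin_cases i <;> fin_cases j <;> simp [cottonPos, Matrix.mul_apply, Fin.sum_univ_three, pow_two]

theorem cottonPos_pow_three (a b : ℝ) : cottonPos a b ^ 3 = 0 := by
  rw [pow_succ, cottonPos_pow_two]
  ext i j
  fin_cases i <;> fin_cases j <;> simp [cottonPos, Matrix.mul_apply, Fin.sum_univ_three]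

/-- If X ^ k is the last nonzero power and k ≥ 1, any nonzero X ^ k y is killed by X, and is null
because moving one X across the inner product by symmetry gives zero. For X = 0 the vector E_1
serves. -/
theorem exists_null_of_pow_three {m : ℕ} {X : Matrix (Fin (m + 2)) (Fin (m + 2)) ℝ}
    (hX : (minkowski m * X)ᵀ = minkowski m * X) (h3 : X ^ 3 = 0) :
    ∃ x, x ≠ 0 ∧ x ⬝ᵥ minkowski m *ᵥ x = 0 ∧ X *ᵥ x = 0 := by
  have hne : ∀ Y : Matrix (Fin (m + 2)) (Fin (m + 2)) ℝ, Y ≠ 0 → ∃ y, Y *ᵥ y ≠ 0 := by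
    intro Y hY
    by_contra! h
    exact hY (Matrix.ext_of_mulVec_single fun i => by rw [h, Matrix.zero_mulVec])
  by_cases h2 : X ^ 2 = 0
  · by_cases h1 : X = 0
    · refine ⟨Pi.single 0 1, by simp, ?_, by rw [h1, Matrix.zero_mulVec]⟩
      have h := minkowski_mulVec (RingHom.id ℝ) (Pi.single 0 1 : Fin (m + 2) → ℝ) 0
      rw [single_dotProduct, one_mul]
      refine Eq.trans h ?_
      simp
    · obtain ⟨y, hy⟩ := hne X h1
      have hXX : X *ᵥ (X *ᵥ y) = 0 := by rw [Matrix.mulVec_mulVec, ← pow_two, h2, Matrix.zero_mulVec]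
      refine ⟨X *ᵥ y, hy, ?_, hXX⟩
      rw [dotProduct_minkowski_of_symm hX, hXX, Matrix.mulVec_zero, dotProduct_zero]
  · obtain ⟨y, hy⟩ := hne _ h2
    have hXX : X *ᵥ (X ^ 2 *ᵥ y) = 0 := by
      rw [Matrix.mulVec_mulVec, ← pow_succ', h3, Matrix.zero_mulVec]
    refine ⟨X ^ 2 *ᵥ y, hy, ?_, hXX⟩
    nth_rewrite 1 [pow_two, ← Matrix.mulVec_mulVec]
    rw [dotProduct_minkowski_of_symm hX, hXX, Matrix.mulVec_zero, dotProduct_zero]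

theorem exists_cottonRep_eq_cottonPos {X : cottonModule}
    (h3 : (X : Matrix (Fin (1 + 2)) (Fin (1 + 2)) ℝ) ^ 3 = 0) :
    ∃ (g : conformalGroup 1) (Y : cottonModule) (a b : ℝ), cottonRep g Y = X ∧
      (Y : Matrix (Fin (1 + 2)) (Fin (1 + 2)) ℝ) = cottonPos a b := by
  obtain ⟨x, hx, hxx, hX⟩ := exists_null_of_pow_three ((mem_cottonModule _).1 X.2).1 h3
  obtain ⟨g, r, rfl⟩ := exists_conformal_of_null hxx
  have hr : r ≠ 0 := fun h => hx (by rw [h, zero_smul])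
  rw [Matrix.mulVec_smul, smul_eq_zero_iff_right hr] at hX
  have hY : (cottonRep g⁻¹ X : Matrix (Fin (1 + 2)) (Fin (1 + 2)) ℝ) *ᵥ Pi.single 0 1 = 0 := by
    rw [cottonRep_coe, inv_inv, Matrix.smul_mulVec, ← Matrix.mulVec_mulVec, ← Matrix.mulVec_mulVec,
      hX, Matrix.mulVec_zero, smul_zero]
  obtain ⟨a, b, hab⟩ := exists_eq_cottonPos (cottonRep g⁻¹ X).2 hY
  exact ⟨g, _, a, b, Representation.self_inv_apply _ _ _, hab⟩

theorem orbitSet_cottonPos :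
    orbitSet cottonRep (cottonPosOne ⊔ cottonPosTwo : Submodule ℝ cottonModule)
      = {X : cottonModule | (X : Matrix (Fin (1 + 2)) (Fin (1 + 2)) ℝ) ^ 3 = 0} := by
  ext X
  constructor
  · rintro ⟨g, Y, hY, rfl⟩
    obtain ⟨a, b, h⟩ := mem_cottonPosOne_sup_cottonPosTwo.1 hY
    change (_ : Matrix _ _ ℝ) ^ 3 = 0
    rw [cottonRep_pow, h, cottonPos_pow_three]
    simp
  · intro hX
    obtain ⟨g, Y, a, b, hg, hY⟩ := exists_cottonRep_eq_cottonPos hX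
    exact ⟨g, Y, mem_cottonPosOne_sup_cottonPosTwo.2 ⟨a, b, hY⟩, hg⟩

/-- Square-zero elements are in particular nilpotent of order three, so they are conjugate up to
scale to some `cottonPos a b`; the corner entry of its square is b ^ 2, which forces b = 0. -/
theorem orbitSet_cottonPosTwo :
    orbitSet cottonRep cottonPosTwo
      = {X : cottonModule | (X : Matrix (Fin (1 + 2)) (Fin (1 + 2)) ℝ) ^ 2 = 0} := by
  ext X
  constructor
  · rintro ⟨g, Y, hY, rfl⟩
    obtain ⟨a, h⟩ := mem_cottonPosTwo.1 hY
    change (_ : Matrix _ _ ℝ) ^ 2 = 0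
    rw [cottonRep_pow, h, cottonPos_pow_two, zero_pow two_ne_zero, ← cottonPos_eq]
    simp
  · intro hX
    have hX2 : (X : Matrix (Fin (1 + 2)) (Fin (1 + 2)) ℝ) ^ 2 = 0 := hX
    obtain ⟨g, Y, a, b, rfl, hY⟩ := exists_cottonRep_eq_cottonPos
      (X := X) (by rw [pow_succ, hX2, zero_mul])
    have hY2 : (Y : Matrix (Fin (1 + 2)) (Fin (1 + 2)) ℝ) ^ 2 = 0 := by
      have h := cottonRep_pow g⁻¹ (cottonRep g Y) 2
      rw [Representation.inv_self_apply, hX2] at h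
      rw [h]
      simp
    have hb : b = 0 := by
      rw [hY, cottonPos_pow_two] at hY2
      simpa [cottonPos] using congrFun (congrFun hY2 0) 2
    exact ⟨g, Y, mem_cottonPosTwo.2 ⟨a, by rw [hY, hb]⟩, rfl⟩

theorem isZariskiClosed_pow_eq_zero (k : ℕ) :
    IsZariskiClosed {X : cottonModule | (X : Matrix (Fin (1 + 2)) (Fin (1 + 2)) ℝ) ^ k = 0} := by
  have h : ∀ i j, (fun X : cottonModule =>
      ((X : Matrix (Fin (1 + 2)) (Fin (1 + 2)) ℝ) ^ k) i j) ∈ polyFunctions cottonModule := by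
    induction k with
    | zero =>
      intro i j
      simp only [pow_zero]
      exact (polyFunctions cottonModule).algebraMap_mem _
    | succ k ih =>
      intro i j
      have : (fun X : cottonModule => ((X : Matrix (Fin (1 + 2)) (Fin (1 + 2)) ℝ) ^ (k + 1)) i j)
          = ∑ l, (fun X : cottonModule => ((X : Matrix (Fin (1 + 2)) (Fin (1 + 2)) ℝ) ^ k) i l)
            * (fun X : cottonModule => (X : Matrix (Fin (1 + 2)) (Fin (1 + 2)) ℝ) l j) := by
        funext X
        simp [pow_succ, Matrix.mul_apply]
      rw [this]
      exact sum_mem fun l _ => mul_mem (ih i l)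
        (dual_mem_polyFunctions (Matrix.entryLinearMap ℝ ℝ l j ∘ₗ cottonModule.subtype))
  convert isZariskiClosed_of_forall
    (fun (p : Fin (1 + 2) × Fin (1 + 2)) (X : cottonModule) =>
      ((X : Matrix (Fin (1 + 2)) (Fin (1 + 2)) ℝ) ^ k) p.1 p.2) (fun p => h p.1 p.2) using 1
  ext X
  exact ⟨fun hX p => congrFun (congrFun hX p.1) p.2, fun hX => Matrix.ext fun i j => hX (i, j)⟩

theorem mainTheorem6 :
    (∀ m : ℕ, 4 ≤ m + 2 →
      IsZariskiClosed (orbitSet (weylRep m) (posRic m)) ∧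
      IsZariskiClosed (orbitSet (weylRep m) (posB m)) ∧
      IsZariskiClosed (orbitSet (weylRep m) (posRic m ∩ weylTensors m)) ∧
      IsZariskiClosed (orbitSet (weylRep m) (posB m ∩ weylTensors m))) ∧
    IsZariskiClosed (orbitSet cottonRep (cottonPosOne ⊔ cottonPosTwo : Submodule ℝ cottonModule)) ∧
    IsZariskiClosed (orbitSet cottonRep cottonPosTwo) := by
  refine ⟨fun m _ => ?_, ?_, ?_⟩
  · have h1 := isZariskiClosed_orbitSet_inter
      (orbitSet_isPosAt (m := m) ▸ isZariskiClosed_exists_isPosAt m)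
    have h2 := isZariskiClosed_orbitSet_inter
      (orbitSet_isNullAt (m := m) ▸ isZariskiClosed_exists_isNullAt m)
    rw [← posRic_eq] at h1
    rw [← posB_eq] at h2
    exact ⟨h1.1, h2.1, h1.2, h2.2⟩
  · rw [orbitSet_cottonPos]
    exact isZariskiClosed_pow_eq_zero 3
  · rw [orbitSet_cottonPosTwo]
    exact isZariskiClosed_pow_eq_zero 2
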